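/- **Conventions.** All registers are finite-dimensional Hilbert spaces, $\log$ is to base $2$, and $\psi$ also denotes the density matrix $|\psi\rangle\langle\psi|$. For subnormalized states $\rho,\sigma$ let $\mathrm F(\rho,\sigma)=\|\sqrt\rho\sqrt\sigma\|_1+\sqrt{(1-\operatorname{Tr}\rho)(1-\operatorname{Tr}\sigma)}$ and let $\mathrm P(\rho,\sigma)=\sqrt{1-\mathrm F(\rho,\sigma)^2}$ be the purified distance. **Protocols.** Let $r$ be odd and let $\Psi_{RBCA}$ be a pure state, with $A,C$ held by Alice, $B$ by Bob and $R$ by a referee. An $r$-round entanglement assisted interactive protocol is given by a shared pure state $\theta_{E_AE_B}$ and the following steps. In each odd round $k\le r$ Alice performs on $ACE_A$ (in each even round Bob performs on $BE_B$) a projective measurement $\{M^{i,i_{k-1},\dots,i_1}\}_{i\ge 1}$ that may depend on the earlier messages $i_1,\dots,i_{k-1}$, and sends the outcome $i_k\in\{1,2,\dots\}$ to the other party. (There is a common finite bound on the outcomes; some projections may be $0$.) Let $p_{i_1,\dots,i_r}$ be the probability of the transcript $(i_1,\dots,i_r)$. After round $r$, depending on the transcript, Alice applies a unitary on $ACE_A$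 and Bob a unitary $BE_B\to BC_0T_B$, where $C_0\equiv C$ and $E_B\equiv C_0T_B$. Let $\Psi'_{RBC_0A}$ be the resulting state on $RBC_0A$, averaged over all transcripts. The protocol *redistributes $\Psi$ with error $\varepsilon$* if $\mathrm P(\Psi'_{RBC_0A},\Psi_{RBC_0A})\le\varepsilon$. When $A$ and $B$ are trivial this is called *state transfer* of $\Psi_{RC}$. The length of a transcript is $\log(i_1 i_2\cdots i_r)$. The *expected communication cost* on $\Psi$ is $\sum p_{i_1,\dots,i_r}\log(i_1 i_2\cdots i_r)$. The *worst-case communication cost* is the maximum of $\log(i_1i_2\cdots i_r)$ over all transcripts along which no measurement projection is zero; these include all transcripts that have nonzero probability on some input. **States.** Let $d,d_a\ge 1$, $e_1\ge e_2\ge\dots\ge e_d>0$ and $\sum_j e_j=1$. Let $R=R_AR'$, where $R_A,A$ have dimension $d_a$ and $R',B,C$ have dimension $d$. Let $\{|u_j\rangle\}_j$ be an orthonormal basis of $R'$ and, for each $a\in\{1,\dots,d_a\}$, let $\{|v_j(a)\rangle\}_j$ and $\{|w_j(a)\rangle\}_j$ be orthonormal bases of $B$ and $C$. Put $$|\Psi\rangle_{RBCA}=\frac1{\sqrt{d_a}}\sum_{a=1}^{d_a}|a\rangle_{R_A}|a\rangle_A\sum_{j=1}^d\sqrt{e_j}\,|u_j\rangle_{R'}|v_j(a)\rangle_B|w_j(a)\rangle_C,$$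 $$|\omega\rangle_{RBCA}=\frac1{\sqrt{d_a}}\sum_{a=1}^{d_a}|a\rangle_{R_A}|a\rangle_A\frac1{\sqrt d}\sum_{j=1}^d|u_j\rangle_{R'}|v_j(a)\rangle_B|w_j(a)\rangle_C .$$ Similarly, for orthonormal bases $\{|u_j\rangle\}_j$, $\{|w_j\rangle\}_j$ of $d$-dimensional registers $R,C$, put $|\tilde\Psi\rangle_{RC}=\sum_{j}\sqrt{e_j}|u_j\rangle|w_j\rangle$ and $|\omega'\rangle_{RC}=\frac1{\sqrt d}\sum_j|u_j\rangle|w_j\rangle$. **Lemma.** Let $r$ be odd, $\varepsilon<1$ and $\mu>0$. 1. If some $r$-round entanglement assisted interactive protocol redistributes $\Psi_{RBCA}$ with error $\varepsilon$ and expected communication cost (on $\Psi$) at most $C$, then there is an $r$-round entanglement assisted interactive protocol that redistributes $\omega_{RBCA}$ with worst-case communication cost at most $\frac{2C}{\mu(1-\varepsilon)}$ and error at most $\sqrt{\frac{8\varepsilon}{e_d\cdot d}}+\sqrt\mu$. 2. The same holds for state transfer, with $\tilde\Psi_{RC}$ in place of $\Psi_{RBCA}$ and $\omega'_{RC}$ in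 place of $\omega_{RBCA}$. -/

import Mathlib

open scoped MatrixOrder Matrix

namespace StateRedistribution

noncomputable section

/-! ### Fidelity and purified distance -/

/-- The trace norm `Tr √(X†X)`. -/
def traceNorm {n : Type*} [Fintype n] [DecidableEq n] (X : Matrix n n ℂ) : ℝ :=
  (CFC.sqrt (Xᴴ * X)).trace.re

/-- Generalized fidelity `‖√ρ √σ‖₁ + √((1 - Tr ρ)(1 - Tr σ))` of two subnormalized states. -/
def fidelity {n : Type*} [Fintype n] [DecidableEq n] (ρ σ : Matrix n n ℂ) : ℝ :=
  traceNorm (CFC.sqrt ρ * CFC.sqrt σ) + √((1 - ρ.trace.re) * (1 - σ.trace.re))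

/-- Purified distance `√(1 - F(ρ, σ)²)`. -/
def purifiedDistance {n : Type*} [Fintype n] [DecidableEq n] (ρ σ : Matrix n n ℂ) : ℝ :=
  √(1 - fidelity ρ σ ^ 2)

/-- The density matrix `|ψ⟩⟨ψ|`. -/
def pureState {n : Type*} (ψ : n → ℂ) : Matrix n n ℂ :=
  Matrix.vecMulVec ψ (star ψ)

/-! ### Interactive protocols -/

/-- A projective measurement with outcomes in `Fin N` (pairwise orthogonality of the projections
follows from their summing to the identity; some of them may be zero). -/
def IsProjectiveMeasurement {n : Type*} [Fintype n] [DecidableEq n] {N : ℕ}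
    (M : Fin N → Matrix n n ℂ) : Prop :=
  (∀ i, IsStarProjection (M i)) ∧ ∑ i, M i = 1

/-- A unitary map from the register `m` to a register `n` of the same dimension. -/
def IsUnitaryMap {m n : Type*} [Fintype m] [Fintype n] [DecidableEq m] [DecidableEq n]
    (U : Matrix n m ℂ) : Prop :=
  Uᴴ * U = 1 ∧ U * Uᴴ = 1

/-- `(I ⊗ M ⊗ I) Φ`, where `M` acts on the middle one of three registers. -/
def applyMid {R X X' Y : Type*} [Fintype X] (M : Matrix X' X ℂ) (Φ : R × X × Y → ℂ) :
    R × X' × Y → ℂ :=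
  fun z => ∑ x, M z.2.1 x * Φ (z.1, x, z.2.2)

/-- `(I ⊗ I ⊗ M) Φ`, where `M` acts on the last one of three registers. -/
def applyLast {R X Y Y' : Type*} [Fintype Y] (M : Matrix Y' Y ℂ) (Φ : R × X × Y → ℂ) :
    R × X × Y' → ℂ :=
  fun z => ∑ y, M z.2.2 y * Φ (z.1, z.2.1, y)

/-- An `r`-round entanglement assisted interactive protocol in which Alice initially holds the
registers `A`, `C`, and Bob holds `B`.

Messages are elements of `Fin N`; the element with value `i` stands for the message `i + 1`, so
that messages are the positive integers `1, …, N`. A history is the list of the messages sent so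
far, the most recent one first. Alice speaks when the length of the history is even (rounds
`1, 3, 5, …`), Bob when it is odd. The speaker makes a projective measurement, which may depend on
the history, and sends the outcome. At the end Alice and Bob apply unitaries that depend on
all `r` messages; Bob's maps `B E_B` to `B C₀ T_B`, where `C₀` is a copy of `C`. -/
structure Protocol (A B C : Type*) [Fintype A] [Fintype B] [Fintype C]
    [DecidableEq A] [DecidableEq B] [DecidableEq C] (r : ℕ) where
  /-- bound on the messages -/
  N : ℕ
  /-- dimension of Alice's part `E_A` of the shared entanglement -/
  dimEA : ℕ
  /-- dimension of Bob's part `E_B` of the shared entanglement -/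
  dimEB : ℕ
  /-- dimension of the register `T_B` left over at Bob's side -/
  dimTB : ℕ
  /-- the shared entangled pure state -/
  θ : Fin dimEA × Fin dimEB → ℂ
  θ_norm : ∑ x, ‖θ x‖ ^ 2 = 1
  measA : List (Fin N) → Fin N → Matrix (A × C × Fin dimEA) (A × C × Fin dimEA) ℂ
  measA_proj : ∀ h, IsProjectiveMeasurement (measA h)
  measB : List (Fin N) → Fin N → Matrix (B × Fin dimEB) (B × Fin dimEB) ℂ
  measB_proj : ∀ h, IsProjectiveMeasurement (measB h)
  finalA : List.Vector (Fin N) r → Matrix (A × C × Fin dimEA) (A × C × Fin dimEA) ℂ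
  finalA_unitary : ∀ m, IsUnitaryMap (finalA m)
  finalB : List.Vector (Fin N) r → Matrix (B × C × Fin dimTB) (B × Fin dimEB) ℂ
  finalB_unitary : ∀ m, IsUnitaryMap (finalB m)

namespace Protocol

variable {R A B C : Type*} [Fintype R] [Fintype A] [Fintype B] [Fintype C]
  [DecidableEq R] [DecidableEq A] [DecidableEq B] [DecidableEq C] {r : ℕ}

/-- The initial global state `|ψ⟩_{RBCA} ⊗ |θ⟩_{E_A E_B}`, with the registers ordered as
`R`, `A C E_A`, `B E_B`. -/
def initial (P : Protocol A B C r) (ψ : R × B × C × A → ℂ) :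
    R × (A × C × Fin P.dimEA) × (B × Fin P.dimEB) → ℂ
  | (x, (a, c, ea), (b, eb)) => ψ (x, b, c, a) * P.θ (ea, eb)

/-- The unnormalized global state after the given history: the composition of the corresponding
measurement projections, applied to the initial state. Its squared norm is the probability of the
history, and normalizing it gives the state conditioned on the history. -/
def run (P : Protocol A B C r) (ψ : R × B × C × A → ℂ) :
    List (Fin P.N) → R × (A × C × Fin P.dimEA) × (B × Fin P.dimEB) → ℂ
  | [] => P.initial ψ
  | i :: h =>
      if Even h.length then applyMid (P.measA h i) (P.run ψ h)
      else applyLast (P.measB h i) (P.run ψ h)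

/-- The probability `p_{i₁, …, i_k}` of a history when the protocol is run on `ψ`. -/
def prob (P : Protocol A B C r) (ψ : R × B × C × A → ℂ) (h : List (Fin P.N)) : ℝ :=
  ∑ z, ‖P.run ψ h z‖ ^ 2

/-- The unnormalized global state `√p • |τ⟩` after the final unitaries. -/
def final (P : Protocol A B C r) (ψ : R × B × C × A → ℂ) (m : List.Vector (Fin P.N) r) :
    R × (A × C × Fin P.dimEA) × (B × C × Fin P.dimTB) → ℂ :=
  applyLast (P.finalB m) (applyMid (P.finalA m) (P.run ψ m.toList))

/-- The output state on `R B C₀ A`: the average over all transcripts of the final states, with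
`C`, `E_A` and `T_B` traced out. -/
def output (P : Protocol A B C r) (ψ : R × B × C × A → ℂ) :
    Matrix (R × B × C × A) (R × B × C × A) ℂ :=
  Matrix.of fun (x, b, c₀, a) (x', b', c₀', a') =>
    ∑ m : List.Vector (Fin P.N) r, ∑ c : C, ∑ ea : Fin P.dimEA, ∑ tb : Fin P.dimTB,
      P.final ψ m (x, (a, c, ea), (b, c₀, tb)) *
        star (P.final ψ m (x', (a', c, ea), (b', c₀', tb)))

/-- The protocol redistributes the pure state `ψ` with error at most `ε`. -/
def Redistributes (P : Protocol A B C r) (ψ : R × B × C × A → ℂ) (ε : ℝ) : Prop :=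
  purifiedDistance (P.output ψ) (pureState ψ) ≤ ε

/-- The length `log₂ (i₁ ⋯ i_k)` in bits of a sequence of messages `i₁, …, i_k ≥ 1`. -/
def bits (P : Protocol A B C r) (h : List (Fin P.N)) : ℝ :=
  Real.logb 2 (h.map fun i : Fin P.N => (i : ℝ) + 1).prod

/-- The expected communication cost `∑ p_{i₁, …, i_r} log₂ (i₁ ⋯ i_r)` on the input `ψ`. -/
def expectedCost (P : Protocol A B C r) (ψ : R × B × C × A → ℂ) : ℝ :=
  ∑ m : List.Vector (Fin P.N) r, P.prob ψ m.toList * P.bits m.toList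

/-- A history is possible if none of the measurement projections along it is zero. Every history
that occurs with nonzero probability on some input is possible. -/
def Possible (P : Protocol A B C r) : List (Fin P.N) → Prop
  | [] => True
  | i :: h => P.Possible h ∧ (if Even h.length then P.measA h i ≠ 0 else P.measB h i ≠ 0)

/-- The worst case communication cost is at most `K`: every possible transcript has at most `K`
bits. -/
def WorstCaseCostLE (P : Protocol A B C r) (K : ℝ) : Prop :=
  ∀ m : List.Vector (Fin P.N) r, P.Possible m.toList → P.bits m.toList ≤ K

end Protocol

/-! ### The states -/

/-- `|ψ^a⟩_{R'BC} = ∑_j √e_j |u_j⟩ |v_j⟩ |w_j⟩`, for a fixed `a`. -/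
def tripartite {d : ℕ} (e : Fin d → ℝ) (u v w : Fin d → EuclideanSpace ℂ (Fin d)) :
    Fin d × Fin d × Fin d → ℂ :=
  fun (x, b, c) => ∑ j, (√(e j) : ℂ) * u j x * v j b * w j c

/-- The GHZ state `|ω^a⟩_{R'BC} = d^{-1/2} ∑_j |u_j⟩ |v_j⟩ |w_j⟩`, for a fixed `a`. -/
def tripartiteGHZ {d : ℕ} (u v w : Fin d → EuclideanSpace ℂ (Fin d)) :
    Fin d × Fin d × Fin d → ℂ :=
  fun (x, b, c) => 1 / (√(d : ℝ) : ℂ) * ∑ j, u j x * v j b * w j c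

/-- `d_a^{-1/2} ∑_a |a⟩_{R_A} |a⟩_A |φ^a⟩_{R'BC}`, with registers ordered `R = R_A R'`, `B`, `C`,
`A`. -/
def controlled {d da : ℕ} (φ : Fin da → Fin d × Fin d × Fin d → ℂ) :
    (Fin da × Fin d) × Fin d × Fin d × Fin da → ℂ :=
  fun ((xa, x), b, c, y) =>
    1 / (√(da : ℝ) : ℂ) *
      ∑ a, (if xa = a then 1 else 0) * (if y = a then 1 else 0) * φ a (x, b, c)

/-- The state `Ψ_{RBCA}`. -/
def Psi {d da : ℕ} (e : Fin d → ℝ) (u : Fin d → EuclideanSpace ℂ (Fin d))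
    (v w : Fin da → Fin d → EuclideanSpace ℂ (Fin d)) :
    (Fin da × Fin d) × Fin d × Fin d × Fin da → ℂ :=
  controlled fun a => tripartite e u (v a) (w a)

/-- The GHZ-type state `ω_{RBCA}`. -/
def omega {d da : ℕ} (u : Fin d → EuclideanSpace ℂ (Fin d))
    (v w : Fin da → Fin d → EuclideanSpace ℂ (Fin d)) :
    (Fin da × Fin d) × Fin d × Fin d × Fin da → ℂ :=
  controlled fun a => tripartiteGHZ u (v a) (w a)

/-- The bipartite state `∑_j √e_j |u_j⟩_R |w_j⟩_C`, with trivial registers `A` and `B`. -/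
def PsiTransfer {d : ℕ} (e : Fin d → ℝ) (u w : Fin d → EuclideanSpace ℂ (Fin d)) :
    Fin d × Unit × Fin d × Unit → ℂ :=
  fun (x, _, c, _) => ∑ j, (√(e j) : ℂ) * u j x * w j c

/-- The maximally entangled state `ω'_{RC} = d^{-1/2} ∑_j |u_j⟩_R |w_j⟩_C`, with trivial registers
`A` and `B`. -/
def omegaTransfer {d : ℕ} (u w : Fin d → EuclideanSpace ℂ (Fin d)) :
    Fin d × Unit × Fin d × Unit → ℂ :=
  fun (x, _, c, _) => 1 / (√(d : ℝ) : ℂ) * ∑ j, u j x * w j c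

end

end StateRedistribution

set_option linter.unusedSectionVars false

namespace StateRedistribution

open scoped ComplexOrder Kronecker

/-! ### Fidelity with a pure state -/

section Fidelity

variable {n : Type*} [Fintype n]

/-! The state `ω` arises from `Ψ` by filtering the reference. The operator `T` that multiplies `u j`
by `√(e l / e j)`, with `e l` the smallest coefficient, is a contraction and maps `Ψ` to `s • ω`
with `s ^ 2 = e l * d`. The protocol never touches the reference, so `T` carries every branch `f i`
of the run on `Ψ` to `s • g i`, with `g i` the same branch of the run on `ω` (`applyRef_branch`).

The overlap of the output with a pure input is the sum of the squared overlaps of the branches.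
Small error on `Ψ` therefore means that `f i = a i • Ψ + b i` with `∑ ‖b i‖ ^ 2 ≤ ε ^ 2`. Applying
`T` gives `∑ ‖g i - a i • ω‖ ^ 2 ≤ ε ^ 2 / s ^ 2`, with the same numbers `a i`. This has two
consequences: the total overlap on `ω` is close to 1, and any set of branches of small total weight
on `Ψ` contributes little overlap on `ω` (`sum_compl_inner_sq_ge`). By Markov's inequality on `Ψ`,
the transcripts longer than `K` bits form such a set, so they may be given up on `ω` too, although
no direct bound on the expected cost on `ω` is available.

It remains to turn "giving up" into a genuine protocol (`truncate`). A message that would exceed `K`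
bits is merged into the message of zero length. Merging alone would superpose the merged branches
with the legitimate one, so each party coherently counts its merged outcomes in an ancilla. The
component with both counters at zero is exactly the original run along short transcripts, and all
other components can only increase the overlap (`sum_overlap_truncate_ge`). `exists_worstCaseCostLE`
combines these facts for arbitrary `ψ`, `φ` related by a contraction. -/

theorem ofReal_sum_norm_sq (ψ : n → ℂ) : ((∑ i, ‖ψ i‖ ^ 2 : ℝ) : ℂ) = star ψ ⬝ᵥ ψ := by
  simp only [dotProduct, Pi.star_apply, Complex.ofReal_sum, RCLike.star_def]
  refine Finset.sum_congr rfl fun i _ => ?_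
  rw [Complex.conj_mul']
  push_cast
  rfl

variable [DecidableEq n]

theorem pureState_mul_mul_pureState (ψ : n → ℂ) (ρ : Matrix n n ℂ) :
    pureState ψ * ρ * pureState ψ = (star ψ ⬝ᵥ ρ *ᵥ ψ) • pureState ψ := by
  unfold pureState
  rw [Matrix.vecMulVec_mul, Matrix.vecMulVec_mul_vecMulVec, ← Matrix.dotProduct_mulVec,
    Matrix.vecMulVec_smul]

theorem trace_pureState {ψ : n → ℂ} (hψ : ∑ i, ‖ψ i‖ ^ 2 = 1) : (pureState ψ).trace = 1 := by
  rw [pureState, Matrix.trace_vecMulVec, dotProduct_comm, ← ofReal_sum_norm_sq, hψ,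
    Complex.ofReal_one]

theorem pureState_nonneg (ψ : n → ℂ) : 0 ≤ pureState ψ :=
  Matrix.nonneg_iff_posSemidef.2 (Matrix.posSemidef_vecMulVec_self_star ψ)

theorem pureState_mul_self {ψ : n → ℂ} (hψ : ∑ i, ‖ψ i‖ ^ 2 = 1) :
    pureState ψ * pureState ψ = pureState ψ := by
  have := pureState_mul_mul_pureState ψ 1
  rwa [mul_one, Matrix.one_mulVec, ← ofReal_sum_norm_sq, hψ, Complex.ofReal_one, one_smul] at this

/-- Since `pureState ψ` is a projection of trace one, it is its own square root, the second term of
the fidelity vanishes, and `(√ρ ψ)ᴴ (√ρ ψ)` is a multiple of `pureState ψ`, whose square root is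
explicit. -/
theorem fidelity_pureState {ρ : Matrix n n ℂ} (hρ : 0 ≤ ρ) {ψ : n → ℂ}
    (hψ : ∑ i, ‖ψ i‖ ^ 2 = 1) :
    fidelity ρ (pureState ψ) = √(star ψ ⬝ᵥ ρ *ᵥ ψ).re := by
  have hnn : 0 ≤ star ψ ⬝ᵥ ρ *ᵥ ψ :=
    (Matrix.nonneg_iff_posSemidef.1 hρ).dotProduct_mulVec_nonneg ψ
  set c := star ψ ⬝ᵥ ρ *ᵥ ψ with hc
  have hcre : c = (c.re : ℂ) := Complex.ext rfl (by simp [← (Complex.nonneg_iff.1 hnn).2])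
  have hre : 0 ≤ c.re := (Complex.nonneg_iff.1 hnn).1
  have h1 : CFC.sqrt (pureState ψ) = pureState ψ :=
    CFC.sqrt_unique (pureState_mul_self hψ) (pureState_nonneg ψ)
  have hsa : (CFC.sqrt ρ)ᴴ = CFC.sqrt ρ :=
    (Matrix.nonneg_iff_posSemidef.1 (CFC.sqrt_nonneg ρ)).isHermitian
  have hpa : (pureState ψ)ᴴ = pureState ψ :=
    (Matrix.nonneg_iff_posSemidef.1 (pureState_nonneg ψ)).isHermitian
  have h2 : (CFC.sqrt ρ * pureState ψ)ᴴ * (CFC.sqrt ρ * pureState ψ) = c • pureState ψ := by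
    rw [Matrix.conjTranspose_mul, hsa, hpa, ← pureState_mul_mul_pureState, Matrix.mul_assoc,
      ← Matrix.mul_assoc (CFC.sqrt ρ), CFC.sqrt_mul_sqrt_self ρ hρ, Matrix.mul_assoc]
  have h3 : CFC.sqrt (c • pureState ψ) = ((√c.re : ℝ) : ℂ) • pureState ψ := by
    apply CFC.sqrt_unique
    · rw [smul_mul_smul_comm, pureState_mul_self hψ, ← Complex.ofReal_mul,
        Real.mul_self_sqrt hre, ← hcre]
    · exact smul_nonneg (by exact_mod_cast Real.sqrt_nonneg _) (pureState_nonneg ψ)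
  unfold fidelity traceNorm
  rw [h1, h2, h3, Matrix.trace_smul, trace_pureState hψ]
  simp

theorem purifiedDistance_pureState {ρ : Matrix n n ℂ} (hρ : 0 ≤ ρ) {ψ : n → ℂ}
    (hψ : ∑ i, ‖ψ i‖ ^ 2 = 1) :
    purifiedDistance ρ (pureState ψ) = √(1 - (star ψ ⬝ᵥ ρ *ᵥ ψ).re) := by
  have hnn : 0 ≤ star ψ ⬝ᵥ ρ *ᵥ ψ :=
    (Matrix.nonneg_iff_posSemidef.1 hρ).dotProduct_mulVec_nonneg ψ
  rw [purifiedDistance, fidelity_pureState hρ hψ, Real.sq_sqrt (Complex.nonneg_iff.1 hnn).1]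

end Fidelity

/-! ### Transfer of overlaps along a contraction -/

section Overlap

variable {ι E : Type*} [Fintype ι] [DecidableEq ι] [NormedAddCommGroup E] [InnerProductSpace ℂ E]

theorem norm_sub_inner_smul_sq {ψ : E} (hψ : ‖ψ‖ = 1) (x : E) :
    ‖x - inner ℂ ψ x • ψ‖ ^ 2 = ‖x‖ ^ 2 - ‖inner ℂ ψ x‖ ^ 2 := by
  have h : inner ℂ (x - inner ℂ ψ x • ψ) (inner ℂ ψ x • ψ) = 0 := by
    rw [inner_smul_right, inner_sub_left, inner_smul_left, inner_self_eq_norm_sq_to_K, hψ]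
    simp
  have h2 := norm_add_sq_eq_norm_sq_add_norm_sq_of_inner_eq_zero _ _ h
  rw [sub_add_cancel, norm_smul, hψ] at h2
  nlinarith

/-- The part of the overlap with `φ` lying outside of `B`, when a contraction `T` maps `ψ` to
`s • φ` and the family `f` to `s • g`. -/
theorem sum_compl_inner_sq_ge {ψ φ : E} (hψ : ‖ψ‖ = 1) (hφ : ‖φ‖ = 1) (T : E →ₗ[ℂ] E)
    (hT : ∀ x, ‖T x‖ ≤ ‖x‖) {s : ℝ} (hs : 0 < s) (hTψ : T ψ = (s : ℂ) • φ) (f g : ι → E)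
    (hfg : ∀ i, T (f i) = (s : ℂ) • g i) (hf : ∑ i, ‖f i‖ ^ 2 = 1) (hg : ∑ i, ‖g i‖ ^ 2 = 1)
    {δ : ℝ} (hδ : 1 - δ ≤ ∑ i, ‖inner ℂ ψ (f i)‖ ^ 2) (B : Finset ι) :
    1 - (2 * ∑ i ∈ B, ‖f i‖ ^ 2 + 3 * δ / s ^ 2) ≤ ∑ i ∈ Bᶜ, ‖inner ℂ φ (g i)‖ ^ 2 := by
  -- Split `f i` into its component along `ψ` and an orthogonal rest `b i`. The total weight of the
  -- rest is at most `δ`, and `T` sends it to `s • (g i - a i • φ)`.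
  set a : ι → ℂ := fun i => inner ℂ ψ (f i) with ha
  set b : ι → E := fun i => f i - a i • ψ with hb
  have hbn : ∀ i, ‖b i‖ ^ 2 = ‖f i‖ ^ 2 - ‖a i‖ ^ 2 := fun i => norm_sub_inner_smul_sq hψ (f i)
  have hTb : ∀ i, T (b i) = (s : ℂ) • (g i - a i • φ) := fun i => by
    rw [hb, map_sub, map_smul, hTψ, hfg, smul_sub, smul_comm]
  have hga : ∀ i, ‖g i - a i • φ‖ ^ 2 ≤ ‖b i‖ ^ 2 / s ^ 2 := fun i => by
    have h := hT (b i)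
    rw [hTb, norm_smul, Complex.norm_real, Real.norm_of_nonneg hs.le] at h
    rw [le_div_iff₀ (by positivity), mul_comm, ← mul_pow]
    exact pow_le_pow_left₀ (by positivity) h 2
  have hinner : ∀ i, inner ℂ φ (g i - a i • φ) = inner ℂ φ (g i) - a i := fun i => by
    rw [inner_sub_right, inner_smul_right, inner_self_eq_norm_sq_to_K, hφ]
    simp
  have hgap : ∀ i, ‖inner ℂ φ (g i) - a i‖ ^ 2 ≤ ‖b i‖ ^ 2 / s ^ 2 := fun i => by
    rw [← hinner]
    refine le_trans (pow_le_pow_left₀ (norm_nonneg _) (norm_inner_le_norm _ _) 2) ?_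
    rw [hφ, one_mul]
    exact hga i
  -- The left side is the squared distance of `g i` from the line spanned by `φ`, hence at most its
  -- squared distance from the point `a i • φ`.
  have hgap2 : ∀ i, ‖g i‖ ^ 2 - ‖inner ℂ φ (g i)‖ ^ 2 ≤ ‖b i‖ ^ 2 / s ^ 2 := fun i => by
    have h := norm_sub_inner_smul_sq hφ (g i - a i • φ)
    have h2 := norm_sub_inner_smul_sq hφ (g i)
    rw [hinner] at h
    have h3 : g i - a i • φ - (inner ℂ φ (g i) - a i) • φ = g i - inner ℂ φ (g i) • φ := by
      rw [sub_smul]; abel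
    rw [h3, h2] at h
    have := hga i
    nlinarith [sq_nonneg ‖inner ℂ φ (g i) - a i‖]
  have hsumb : ∑ i, ‖b i‖ ^ 2 / s ^ 2 ≤ δ / s ^ 2 := by
    rw [← Finset.sum_div]
    gcongr
    simp_rw [hbn]
    rw [Finset.sum_sub_distrib, hf]
    linarith
  -- Here `(x + y)² ≤ 2x² + 2y²` is used, with `‖a i‖ ≤ ‖f i‖`: the weight of `B` is measured on the
  -- side of `ψ`, where it is known.
  have hB : ∑ i ∈ B, ‖inner ℂ φ (g i)‖ ^ 2 ≤ 2 * ∑ i ∈ B, ‖f i‖ ^ 2 + 2 * (δ / s ^ 2) := by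
    calc ∑ i ∈ B, ‖inner ℂ φ (g i)‖ ^ 2
        ≤ ∑ i ∈ B, (2 * ‖f i‖ ^ 2 + 2 * (‖b i‖ ^ 2 / s ^ 2)) := by
          refine Finset.sum_le_sum fun i _ => ?_
          have h1 : ‖inner ℂ φ (g i)‖ ≤ ‖a i‖ + ‖inner ℂ φ (g i) - a i‖ := by
            simpa using norm_add_le (a i) (inner ℂ φ (g i) - a i)
          have h2 := hgap i
          have h3 : ‖a i‖ ^ 2 ≤ ‖f i‖ ^ 2 := by
            have := hbn i
            nlinarith [sq_nonneg ‖b i‖]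
          have h4 := pow_le_pow_left₀ (norm_nonneg _) h1 2
          nlinarith [sq_nonneg (‖a i‖ - ‖inner ℂ φ (g i) - a i‖)]
      _ = 2 * ∑ i ∈ B, ‖f i‖ ^ 2 + 2 * ∑ i ∈ B, ‖b i‖ ^ 2 / s ^ 2 := by
          rw [Finset.sum_add_distrib, Finset.mul_sum, Finset.mul_sum]
      _ ≤ _ := by
          have : ∑ i ∈ B, ‖b i‖ ^ 2 / s ^ 2 ≤ ∑ i, ‖b i‖ ^ 2 / s ^ 2 :=
            Finset.sum_le_univ_sum_of_nonneg fun i => by positivity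
          linarith
  -- The constant 3 is made up of one `δ / s ^ 2` lost in the total overlap and two in the part on
  -- `B`.
  have hall := Finset.sum_le_sum fun i (_ : i ∈ Finset.univ) => hgap2 i
  rw [Finset.sum_sub_distrib, hg] at hall
  have hsplit := Finset.sum_add_sum_compl B fun i => ‖inner ℂ φ (g i)‖ ^ 2
  have : 3 * δ / s ^ 2 = 3 * (δ / s ^ 2) := by ring
  linarith

end Overlap

/-! ### Isometries and local operations -/

section LocalOperations

variable {R X X' X'' Y Y' Y'' ι : Type*}

theorem sum_norm_sq_mulVec [Fintype X] [Fintype X'] [DecidableEq X] [Fintype ι]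
    {M : ι → Matrix X' X ℂ} (hM : ∑ i, (M i)ᴴ * M i = 1) (v : X → ℂ) :
    ∑ i, ∑ y, ‖(M i *ᵥ v) y‖ ^ 2 = ∑ x, ‖v x‖ ^ 2 := by
  have key : ∀ i, ((∑ y, ‖(M i *ᵥ v) y‖ ^ 2 : ℝ) : ℂ) = star v ⬝ᵥ ((M i)ᴴ * M i) *ᵥ v :=
    fun i => by
      rw [ofReal_sum_norm_sq (M i *ᵥ v), Matrix.star_mulVec, Matrix.dotProduct_mulVec,
        Matrix.vecMul_vecMul, ← Matrix.dotProduct_mulVec]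
  apply Complex.ofReal_injective
  rw [Complex.ofReal_sum, Finset.sum_congr rfl fun i _ => key i, ← dotProduct_sum,
    ← Matrix.sum_mulVec, hM, Matrix.one_mulVec, ofReal_sum_norm_sq]

variable [Fintype R] [Fintype X] [Fintype X'] [Fintype X''] [Fintype Y] [Fintype Y'] [Fintype Y'']

theorem applyMid_apply (M : Matrix X' X ℂ) (Φ : R × X × Y → ℂ) (r : R) (x : X') (y : Y) :
    applyMid M Φ (r, x, y) = (M *ᵥ fun x' => Φ (r, x', y)) x := rfl

theorem applyLast_apply (M : Matrix Y' Y ℂ) (Φ : R × X × Y → ℂ) (r : R) (x : X) (y : Y') :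
    applyLast M Φ (r, x, y) = (M *ᵥ fun y' => Φ (r, x, y')) y := rfl

theorem sum_norm_sq_swap (Φ : R × X × Y → ℂ) :
    ∑ z, ‖Φ z‖ ^ 2 = ∑ r, ∑ y, ∑ x, ‖Φ (r, x, y)‖ ^ 2 := by
  simp_rw [Fintype.sum_prod_type]
  exact Finset.sum_congr rfl fun r _ => Finset.sum_comm

theorem sum_norm_sq_applyMid [DecidableEq X] [Fintype ι] {M : ι → Matrix X' X ℂ}
    (hM : ∑ i, (M i)ᴴ * M i = 1) (Φ : R × X × Y → ℂ) :
    ∑ i, ∑ z, ‖applyMid (M i) Φ z‖ ^ 2 = ∑ z, ‖Φ z‖ ^ 2 := by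
  simp_rw [sum_norm_sq_swap, applyMid_apply]
  rw [Finset.sum_comm]
  refine Finset.sum_congr rfl fun r _ => ?_
  rw [Finset.sum_comm]
  exact Finset.sum_congr rfl fun y _ => sum_norm_sq_mulVec hM _

theorem sum_norm_sq_applyLast [DecidableEq Y] [Fintype ι] {M : ι → Matrix Y' Y ℂ}
    (hM : ∑ i, (M i)ᴴ * M i = 1) (Φ : R × X × Y → ℂ) :
    ∑ i, ∑ z, ‖applyLast (M i) Φ z‖ ^ 2 = ∑ z, ‖Φ z‖ ^ 2 := by
  simp_rw [Fintype.sum_prod_type, applyLast_apply]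
  rw [Finset.sum_comm]
  refine Finset.sum_congr rfl fun r _ => ?_
  rw [Finset.sum_comm]
  exact Finset.sum_congr rfl fun x _ => sum_norm_sq_mulVec hM _

theorem applyMid_applyMid (M : Matrix X'' X' ℂ) (M' : Matrix X' X ℂ) (Φ : R × X × Y → ℂ) :
    applyMid M (applyMid M' Φ) = applyMid (M * M') Φ := by
  funext ⟨r, x, y⟩
  simp only [applyMid_apply, ← Matrix.mulVec_mulVec]

theorem applyLast_applyLast (M : Matrix Y'' Y' ℂ) (M' : Matrix Y' Y ℂ) (Φ : R × X × Y → ℂ) :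
    applyLast M (applyLast M' Φ) = applyLast (M * M') Φ := by
  funext ⟨r, x, y⟩
  simp only [applyLast_apply, ← Matrix.mulVec_mulVec]

theorem applyMid_applyLast (M : Matrix X' X ℂ) (M' : Matrix Y' Y ℂ) (Φ : R × X × Y → ℂ) :
    applyMid M (applyLast M' Φ) = applyLast M' (applyMid M Φ) := by
  funext ⟨r, x, y⟩
  simp only [applyMid, applyLast, Finset.mul_sum]
  rw [Finset.sum_comm]
  exact Finset.sum_congr rfl fun _ _ => Finset.sum_congr rfl fun _ _ => by ring

theorem applyMid_one [DecidableEq X] (Φ : R × X × Y → ℂ) : applyMid 1 Φ = Φ := by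
  funext ⟨r, x, y⟩
  rw [applyMid_apply, Matrix.one_mulVec]

theorem applyLast_one [DecidableEq Y] (Φ : R × X × Y → ℂ) : applyLast 1 Φ = Φ := by
  funext ⟨r, x, y⟩
  rw [applyLast_apply, Matrix.one_mulVec]

/-- `(T ⊗ I) Φ`, where `T` acts on the reference register. -/
noncomputable def applyRef (T : Matrix R R ℂ) (Φ : R × Y → ℂ) : R × Y → ℂ :=
  fun z => ∑ r, T z.1 r * Φ (r, z.2)

/-- Operators on different tensor factors commute. This is what lets a filter on the reference pass
through a whole protocol. -/
theorem applyRef_applyMid (T : Matrix R R ℂ) (M : Matrix X' X ℂ) (Φ : R × X × Y → ℂ) :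
    applyRef T (applyMid M Φ) = applyMid M (applyRef T Φ) := by
  funext ⟨r, x, y⟩
  simp only [applyMid, applyRef, Finset.mul_sum]
  rw [Finset.sum_comm]
  exact Finset.sum_congr rfl fun _ _ => Finset.sum_congr rfl fun _ _ => by ring

theorem applyRef_applyLast (T : Matrix R R ℂ) (M : Matrix Y' Y ℂ) (Φ : R × X × Y → ℂ) :
    applyRef T (applyLast M Φ) = applyLast M (applyRef T Φ) := by
  funext ⟨r, x, y⟩
  simp only [applyLast, applyRef, Finset.mul_sum]
  rw [Finset.sum_comm]
  exact Finset.sum_congr rfl fun _ _ => Finset.sum_congr rfl fun _ _ => by ring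

theorem applyMid_smul (M : Matrix X' X ℂ) (c : ℂ) (Φ : R × X × Y → ℂ) :
    applyMid M (c • Φ) = c • applyMid M Φ := by
  funext z
  simp only [applyMid, Pi.smul_apply, smul_eq_mul, Finset.mul_sum]
  exact Finset.sum_congr rfl fun _ _ => by ring

theorem applyLast_smul (M : Matrix Y' Y ℂ) (c : ℂ) (Φ : R × X × Y → ℂ) :
    applyLast M (c • Φ) = c • applyLast M Φ := by
  funext z
  simp only [applyLast, Pi.smul_apply, smul_eq_mul, Finset.mul_sum]
  exact Finset.sum_congr rfl fun _ _ => by ring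

end LocalOperations

/-! ### Sums over transcripts -/

theorem sum_vector_succ {α M : Type*} [Fintype α] [AddCommMonoid M] (k : ℕ) (f : List α → M) :
    ∑ m : List.Vector α (k + 1), f m.toList
      = ∑ m : List.Vector α k, ∑ i, f (i :: m.toList) := by
  let e : List.Vector α (k + 1) ≃ List.Vector α k × α :=
    ⟨fun m => (m.tail, m.head), fun p => p.2 ::ᵥ p.1, fun m => by simp, fun p => by simp⟩
  rw [← e.symm.sum_comp, Fintype.sum_prod_type]
  rfl

theorem sum_vector_zero {α M : Type*} [Fintype α] [AddCommMonoid M] (f : List α → M) :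
    ∑ m : List.Vector α 0, f m.toList = f [] := by
  rw [Fintype.sum_eq_single List.Vector.nil fun m hm => absurd (List.Vector.eq_nil m) hm]
  rfl

/-! ### Projective measurements -/

section Measurements

variable {n m : Type*} [Fintype n] [DecidableEq n] [Fintype m] [DecidableEq m] {N : ℕ}

/-- Sandwiching `∑ k, M k = 1` between two copies of `M j` shows that the positive matrices `(M k *
M j)ᴴ * (M k * M j)`, `k ≠ j`, add up to zero, so each of them vanishes. -/
theorem IsProjectiveMeasurement.mul_eq_zero {M : Fin N → Matrix n n ℂ}
    (hM : IsProjectiveMeasurement M) {i j : Fin N} (hij : i ≠ j) : M i * M j = 0 := by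
  have hsq : ∀ k, M k * M k = M k := fun k => (hM.1 k).isIdempotentElem
  have hsa : ∀ k, (M k)ᴴ = M k := fun k => (hM.1 k).isSelfAdjoint
  have hpos : ∀ k, (M k * M j)ᴴ * (M k * M j) = M j * M k * M j := fun k => by
    rw [Matrix.conjTranspose_mul, hsa, hsa, Matrix.mul_assoc, ← Matrix.mul_assoc (M k), hsq,
      Matrix.mul_assoc]
  have hsum : ∑ k ∈ Finset.univ.erase j, (M k * M j)ᴴ * (M k * M j) = 0 := by
    have h1 : ∑ k, M j * M k * M j = M j := by
      rw [← Finset.sum_mul, ← Finset.mul_sum, hM.2, mul_one, hsq]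
    rw [← Finset.add_sum_erase _ _ (Finset.mem_univ j), hsq, hsq] at h1
    simp_rw [hpos]
    simpa using h1
  have hz := (Finset.sum_eq_zero_iff_of_nonneg fun k _ =>
    Matrix.nonneg_iff_posSemidef.2 (Matrix.posSemidef_conjTranspose_mul_self (M k * M j))).1 hsum i
      (Finset.mem_erase.2 ⟨hij, Finset.mem_univ i⟩)
  exact Matrix.conjTranspose_mul_self_eq_zero.1 hz

theorem IsProjectiveMeasurement.mul_sum {M : Fin N → Matrix n n ℂ}
    (hM : IsProjectiveMeasurement M) (i : Fin N) (B : Finset (Fin N)) :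
    M i * ∑ j ∈ B, M j = if i ∈ B then M i else 0 := by
  rw [Finset.mul_sum]
  split_ifs with h
  · rw [Finset.sum_eq_single_of_mem i h fun j _ hj => hM.mul_eq_zero hj.symm]
    exact (hM.1 i).isIdempotentElem
  · exact Finset.sum_eq_zero fun j hj => hM.mul_eq_zero fun hij => h (hij ▸ hj)

theorem IsProjectiveMeasurement.sum_mul {M : Fin N → Matrix n n ℂ}
    (hM : IsProjectiveMeasurement M) (i : Fin N) (B : Finset (Fin N)) :
    (∑ j ∈ B, M j) * M i = if i ∈ B then M i else 0 := by
  rw [Finset.sum_mul]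
  split_ifs with h
  · rw [Finset.sum_eq_single_of_mem i h fun j _ hj => hM.mul_eq_zero hj]
    exact (hM.1 i).isIdempotentElem
  · exact Finset.sum_eq_zero fun j hj => hM.mul_eq_zero fun hij => h (hij ▸ hj)

theorem IsProjectiveMeasurement.isStarProjection_sum {M : Fin N → Matrix n n ℂ}
    (hM : IsProjectiveMeasurement M) (B : Finset (Fin N)) :
    IsStarProjection (∑ j ∈ B, M j) where
  isIdempotentElem := by
    rw [IsIdempotentElem, Finset.sum_mul]
    exact Finset.sum_congr rfl fun i hi => by rw [hM.mul_sum, if_pos hi]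
  isSelfAdjoint := by
    rw [IsSelfAdjoint, star_sum]
    exact Finset.sum_congr rfl fun i _ => (hM.1 i).isSelfAdjoint

theorem IsProjectiveMeasurement.sum_conjTranspose_mul {M : Fin N → Matrix n n ℂ}
    (hM : IsProjectiveMeasurement M) : ∑ i, (M i)ᴴ * M i = 1 := by
  rw [← hM.2]
  refine Finset.sum_congr rfl fun i _ => ?_
  have h1 : (M i)ᴴ = M i := (hM.1 i).isSelfAdjoint
  rw [h1]
  exact (hM.1 i).isIdempotentElem

theorem IsProjectiveMeasurement.conj {M : Fin N → Matrix n n ℂ}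
    (hM : IsProjectiveMeasurement M) {W : Matrix n n ℂ} (hW : IsUnitaryMap W) :
    IsProjectiveMeasurement fun i => Wᴴ * M i * W := by
  refine ⟨fun i => ⟨?_, ?_⟩, ?_⟩
  · have h : M i * M i = M i := (hM.1 i).isIdempotentElem
    calc Wᴴ * M i * W * (Wᴴ * M i * W) = Wᴴ * M i * (W * Wᴴ) * M i * W := by
          simp only [Matrix.mul_assoc]
      _ = Wᴴ * (M i * M i) * W := by rw [hW.2, Matrix.mul_one, Matrix.mul_assoc Wᴴ]
      _ = _ := by rw [h]
  · have h : (M i)ᴴ = M i := (hM.1 i).isSelfAdjoint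
    rw [IsSelfAdjoint, Matrix.star_eq_conjTranspose]
    simp [Matrix.conjTranspose_mul, h, Matrix.mul_assoc]
  · rw [← Finset.sum_mul, ← Finset.mul_sum, hM.2, Matrix.mul_one, hW.1]

theorem IsProjectiveMeasurement.submatrix {M : Fin N → Matrix n n ℂ}
    (hM : IsProjectiveMeasurement M) (f : m ≃ n) :
    IsProjectiveMeasurement fun i => (M i).submatrix f f := by
  refine ⟨fun i => ⟨?_, ?_⟩, ?_⟩
  · have h : M i * M i = M i := (hM.1 i).isIdempotentElem
    rw [IsIdempotentElem, Matrix.submatrix_mul_equiv, h]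
  · have h : (M i)ᴴ = M i := (hM.1 i).isSelfAdjoint
    rw [IsSelfAdjoint, Matrix.star_eq_conjTranspose, Matrix.conjTranspose_submatrix, h]
  · ext x y
    have h := congr_fun (congr_fun hM.2 (f x)) (f y)
    rw [Matrix.sum_apply] at h ⊢
    simpa [Matrix.one_apply] using h

theorem IsProjectiveMeasurement.kronecker_one {M : Fin N → Matrix n n ℂ}
    (hM : IsProjectiveMeasurement M) :
    IsProjectiveMeasurement fun i => M i ⊗ₖ (1 : Matrix m m ℂ) := by
  refine ⟨fun i => ⟨?_, ?_⟩, ?_⟩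
  · have h : M i * M i = M i := (hM.1 i).isIdempotentElem
    rw [IsIdempotentElem, ← Matrix.mul_kronecker_mul, h, Matrix.mul_one]
  · have h : (M i)ᴴ = M i := (hM.1 i).isSelfAdjoint
    rw [IsSelfAdjoint, Matrix.star_eq_conjTranspose, Matrix.conjTranspose_kronecker, h,
      Matrix.conjTranspose_one]
  · ext ⟨x, c⟩ ⟨y, c'⟩
    have h := congr_fun (congr_fun hM.2 x) y
    rw [Matrix.sum_apply] at h ⊢
    simp only [Matrix.kroneckerMap_apply]
    rw [← Finset.sum_mul, h]
    by_cases hx : x = y <;> by_cases hc : c = c' <;> simp [Matrix.one_apply, hx, hc]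

/-- The measurement in which the outcomes in `B` are merged into the outcome `i₀`. -/
noncomputable def mergeOutcomes (M : Fin N → Matrix n n ℂ) (i₀ : Fin N) (B : Finset (Fin N))
    (i : Fin N) : Matrix n n ℂ :=
  if i ∈ B then 0 else if i = i₀ then M i + ∑ j ∈ B, M j else M i

theorem IsProjectiveMeasurement.mergeOutcomes {M : Fin N → Matrix n n ℂ}
    (hM : IsProjectiveMeasurement M) {i₀ : Fin N} {B : Finset (Fin N)} (hB : i₀ ∉ B) :
    IsProjectiveMeasurement (mergeOutcomes M i₀ B) := by
  refine ⟨fun i => ?_, ?_⟩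
  · unfold StateRedistribution.mergeOutcomes
    split_ifs with h1 h2
    · exact .zero _
    · exact (hM.1 i).add (hM.isStarProjection_sum B) (by rw [hM.mul_sum, if_neg h1])
    · exact hM.1 i
  · have h : ∀ i, StateRedistribution.mergeOutcomes M i₀ B i
        = M i - (if i ∈ B then M i else 0) + if i = i₀ then ∑ j ∈ B, M j else 0 := fun i => by
      unfold StateRedistribution.mergeOutcomes
      split_ifs with h1 h2 h2
      · exact absurd h1 (h2 ▸ hB)
      all_goals simp
    simp_rw [h]
    rw [Finset.sum_add_distrib, Finset.sum_sub_distrib, hM.2]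
    simp

/-! ### Unitaries that count merged outcomes -/

/-- The cyclic shift of a counter with `r + 1` values. -/
noncomputable def counterShift (r : ℕ) : Matrix (Fin (r + 1)) (Fin (r + 1)) ℂ :=
  Equiv.Perm.permMatrix ℂ (Equiv.subRight (1 : Fin (r + 1)))

theorem isUnitaryMap_counterShift (r : ℕ) : IsUnitaryMap (counterShift r) := by
  constructor <;>
  rw [counterShift, Matrix.conjTranspose_permMatrix, ← Matrix.permMatrix_mul] <;> simp

/-- The unitary increasing the counter by one on the range of the projection `Q`. -/
noncomputable def countUnitary (Q : Matrix n n ℂ) (r : ℕ) :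
    Matrix (n × Fin (r + 1)) (n × Fin (r + 1)) ℂ :=
  (1 - Q) ⊗ₖ 1 + Q ⊗ₖ counterShift r

theorem isUnitaryMap_countUnitary {Q : Matrix n n ℂ} (hQ : IsStarProjection Q) (r : ℕ) :
    IsUnitaryMap (countUnitary Q r) := by
  have h1 : (1 - Q) * Q = 0 := hQ.one_sub_mul_self
  have h2 : Q * (1 - Q) = 0 := hQ.mul_one_sub_self
  have h3 : Q * Q = Q := hQ.isIdempotentElem
  have h4 : (1 - Q) * (1 - Q) = 1 - Q := hQ.one_sub.isIdempotentElem
  have h5 : Qᴴ = Q := hQ.isSelfAdjoint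
  have h6 : (1 - Q)ᴴ = 1 - Q := hQ.one_sub.isSelfAdjoint
  have hX := isUnitaryMap_counterShift r
  have hone : (1 - Q) ⊗ₖ (1 : Matrix (Fin (r + 1)) (Fin (r + 1)) ℂ) + Q ⊗ₖ 1 = 1 := by
    rw [← Matrix.add_kronecker, sub_add_cancel, Matrix.one_kronecker_one]
  constructor <;>
  · rw [countUnitary, Matrix.conjTranspose_add, Matrix.conjTranspose_kronecker,
      Matrix.conjTranspose_kronecker, h5, h6, Matrix.conjTranspose_one, add_mul, mul_add, mul_add]
    simp only [← Matrix.mul_kronecker_mul, h1, h2, h3, h4, hX.1, hX.2, Matrix.zero_kronecker,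
      Matrix.mul_one, add_zero, zero_add, hone]

/-- After the merged measurement the counting unitary separates what was merged: the legitimate
outcome keeps its counter value, and the overflow part, which occurs only under `i₀`, has its
counter raised by one. -/
theorem countUnitary_mul_mergeOutcomes {M : Fin N → Matrix n n ℂ}
    (hM : IsProjectiveMeasurement M) {i₀ : Fin N} {B : Finset (Fin N)} (hB : i₀ ∉ B) (r : ℕ)
    (i : Fin N) :
    countUnitary (∑ j ∈ B, M j) r * (mergeOutcomes M i₀ B i ⊗ₖ 1)
      = (if i ∈ B then 0 else M i) ⊗ₖ 1
        + (if i = i₀ then ∑ j ∈ B, M j else 0) ⊗ₖ counterShift r := by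
  have hQ : (∑ j ∈ B, M j) * ∑ j ∈ B, M j = ∑ j ∈ B, M j :=
    (hM.isStarProjection_sum B).isIdempotentElem
  rw [countUnitary, add_mul, ← Matrix.mul_kronecker_mul, ← Matrix.mul_kronecker_mul,
    Matrix.mul_one, Matrix.mul_one, sub_mul, one_mul]
  unfold mergeOutcomes
  split_ifs with h1 h2 h2
  · exact absurd h1 (h2 ▸ hB)
  · simp
  · rw [mul_add, hQ, hM.sum_mul, if_neg h1, zero_add, add_sub_cancel_right]
  · rw [hM.sum_mul, if_neg h1, sub_zero]

theorem kronecker_counter_mulVec (D E : Matrix m n ℂ) (r : ℕ) (v : n × Fin (r + 1) → ℂ) (y : m)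
    (c : Fin (r + 1)) :
    ((D ⊗ₖ (1 : Matrix (Fin (r + 1)) (Fin (r + 1)) ℂ) + E ⊗ₖ counterShift r) *ᵥ v) (y, c)
      = (D *ᵥ fun x => v (x, c)) y + (E *ᵥ fun x => v (x, c - 1)) y := by
  rw [Matrix.add_mulVec, Pi.add_apply]
  congr 1 <;>
  · simp only [Matrix.mulVec, dotProduct, Fintype.sum_prod_type, Matrix.kroneckerMap_apply]
    refine Finset.sum_congr rfl fun x _ => ?_
    simp [Matrix.one_apply, counterShift, Equiv.Perm.permMatrix, PEquiv.toMatrix_apply]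

theorem kronecker_one_mulVec (D : Matrix m n ℂ) (r : ℕ) (v : n × Fin (r + 1) → ℂ) (y : m)
    (c : Fin (r + 1)) :
    ((D ⊗ₖ (1 : Matrix (Fin (r + 1)) (Fin (r + 1)) ℂ)) *ᵥ v) (y, c)
      = (D *ᵥ fun x => v (x, c)) y := by
  have h := kronecker_counter_mulVec D 0 r v y c
  simpa using h

theorem IsUnitaryMap.mul {l : Type*} [Fintype l] [DecidableEq l] {U : Matrix l m ℂ}
    {V : Matrix m n ℂ} (hU : IsUnitaryMap U) (hV : IsUnitaryMap V) : IsUnitaryMap (U * V) := by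
  constructor
  · rw [Matrix.conjTranspose_mul, Matrix.mul_assoc, ← Matrix.mul_assoc Uᴴ, hU.1, Matrix.one_mul,
      hV.1]
  · rw [Matrix.conjTranspose_mul, Matrix.mul_assoc, ← Matrix.mul_assoc V, hV.2, Matrix.one_mul,
      hU.2]

theorem isUnitaryMap_one : IsUnitaryMap (1 : Matrix n n ℂ) := by
  constructor <;> simp

theorem IsUnitaryMap.kronecker_one {U : Matrix m n ℂ} (hU : IsUnitaryMap U) {l : Type*}
    [Fintype l] [DecidableEq l] : IsUnitaryMap (U ⊗ₖ (1 : Matrix l l ℂ)) := by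
  constructor
  · rw [Matrix.conjTranspose_kronecker, ← Matrix.mul_kronecker_mul, hU.1,
      Matrix.conjTranspose_one, Matrix.one_mul, Matrix.one_kronecker_one]
  · rw [Matrix.conjTranspose_kronecker, ← Matrix.mul_kronecker_mul, hU.2,
      Matrix.conjTranspose_one, Matrix.one_mul, Matrix.one_kronecker_one]

theorem IsUnitaryMap.submatrix {U : Matrix m n ℂ} (hU : IsUnitaryMap U) {m' n' : Type*}
    [Fintype m'] [DecidableEq m'] [Fintype n'] [DecidableEq n'] (f : m' ≃ m) (g : n' ≃ n) :
    IsUnitaryMap (U.submatrix f g) := by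
  constructor
  · rw [Matrix.conjTranspose_submatrix, Matrix.submatrix_mul_equiv, hU.1,
      Matrix.submatrix_one_equiv]
  · rw [Matrix.conjTranspose_submatrix, Matrix.submatrix_mul_equiv, hU.2,
      Matrix.submatrix_one_equiv]

end Measurements

namespace Protocol

variable {R A B C : Type*} [Fintype R] [Fintype A] [Fintype B] [Fintype C]
  [DecidableEq R] [DecidableEq A] [DecidableEq B] [DecidableEq C] {r : ℕ}

/-! ### Probabilities and lengths of transcripts -/

theorem sum_norm_sq_initial (P : Protocol A B C r) (ψ : R × B × C × A → ℂ) :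
    ∑ z, ‖P.initial ψ z‖ ^ 2 = ∑ z, ‖ψ z‖ ^ 2 := by
  let f : (R × (A × C × Fin P.dimEA) × (B × Fin P.dimEB)) ≃
      (R × B × C × A) × (Fin P.dimEA × Fin P.dimEB) :=
    ⟨fun z => ((z.1, z.2.2.1, z.2.1.2.1, z.2.1.1), (z.2.1.2.2, z.2.2.2)),
      fun w => (w.1.1, (w.1.2.2.2, w.1.2.2.1, w.2.1), (w.1.2.1, w.2.2)), fun _ => rfl, fun _ => rfl⟩
  rw [← f.symm.sum_comp, Fintype.sum_prod_type]
  refine Finset.sum_congr rfl fun w _ => ?_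
  calc ∑ y, ‖ψ w * P.θ y‖ ^ 2 = ‖ψ w‖ ^ 2 * ∑ y, ‖P.θ y‖ ^ 2 := by
        simp_rw [norm_mul, mul_pow, Finset.mul_sum]
    _ = ‖ψ w‖ ^ 2 := by rw [P.θ_norm, mul_one]

theorem sum_prob_cons (P : Protocol A B C r) (ψ : R × B × C × A → ℂ) (h : List (Fin P.N)) :
    ∑ i, P.prob ψ (i :: h) = P.prob ψ h := by
  by_cases hh : Even h.length
  · simp only [prob, run, hh, if_true]
    exact sum_norm_sq_applyMid (P.measA_proj h).sum_conjTranspose_mul _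
  · simp only [prob, run, hh, if_false]
    exact sum_norm_sq_applyLast (P.measB_proj h).sum_conjTranspose_mul _

theorem sum_prob (P : Protocol A B C r) (ψ : R × B × C × A → ℂ) (k : ℕ) :
    ∑ m : List.Vector (Fin P.N) k, P.prob ψ m.toList = ∑ z, ‖ψ z‖ ^ 2 := by
  induction k with
  | zero =>
    rw [sum_vector_zero]
    exact P.sum_norm_sq_initial ψ
  | succ k ih =>
    rw [sum_vector_succ, ← ih]
    exact Finset.sum_congr rfl fun m _ => P.sum_prob_cons ψ _

theorem prob_nonneg (P : Protocol A B C r) (ψ : R × B × C × A → ℂ) (h : List (Fin P.N)) :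
    0 ≤ P.prob ψ h :=
  Finset.sum_nonneg fun _ _ => by positivity

theorem sum_norm_sq_final (P : Protocol A B C r) (ψ : R × B × C × A → ℂ)
    (m : List.Vector (Fin P.N) r) : ∑ z, ‖P.final ψ m z‖ ^ 2 = P.prob ψ m.toList := by
  have h1 := sum_norm_sq_applyLast (ι := Unit) (M := fun _ => P.finalB m)
    (by simpa using (P.finalB_unitary m).1) (applyMid (P.finalA m) (P.run ψ m.toList))
  have h2 := sum_norm_sq_applyMid (ι := Unit) (M := fun _ => P.finalA m)
    (by simpa using (P.finalA_unitary m).1) (P.run ψ m.toList)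
  simp only [Finset.univ_unique, Finset.sum_singleton] at h1 h2
  exact h1.trans h2

theorem one_le_prod (P : Protocol A B C r) (h : List (Fin P.N)) :
    1 ≤ (h.map fun i : Fin P.N => (i : ℝ) + 1).prod := by
  induction h with
  | nil => simp
  | cons i h ih =>
    rw [List.map_cons, List.prod_cons]
    exact one_le_mul_of_one_le_of_one_le (by simp) ih

theorem bits_nonneg (P : Protocol A B C r) (h : List (Fin P.N)) : 0 ≤ P.bits h :=
  Real.logb_nonneg one_lt_two (P.one_le_prod h)

theorem bits_nil (P : Protocol A B C r) : P.bits [] = 0 := by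
  simp [bits]

theorem bits_cons (P : Protocol A B C r) (i : Fin P.N) (h : List (Fin P.N)) :
    P.bits (i :: h) = Real.logb 2 ((i : ℝ) + 1) + P.bits h := by
  rw [bits, List.map_cons, List.prod_cons, Real.logb_mul (by positivity)
    (zero_lt_one.trans_le (P.one_le_prod h)).ne', bits]

theorem bits_le_bits_cons (P : Protocol A B C r) (i : Fin P.N) (h : List (Fin P.N)) :
    P.bits h ≤ P.bits (i :: h) := by
  rw [bits_cons]
  exact le_add_of_nonneg_left (Real.logb_nonneg one_lt_two (by simp))

theorem expectedCost_nonneg (P : Protocol A B C r) (ψ : R × B × C × A → ℂ) :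
    0 ≤ P.expectedCost ψ :=
  Finset.sum_nonneg fun _ _ => mul_nonneg (P.prob_nonneg ψ _) (P.bits_nonneg _)

/-- Markov's inequality for the number of bits sent. -/
theorem mul_sum_prob_le_expectedCost (P : Protocol A B C r) (ψ : R × B × C × A → ℂ) (K : ℝ) :
    K * ∑ m : List.Vector (Fin P.N) r with K < P.bits m.toList, P.prob ψ m.toList
      ≤ P.expectedCost ψ := by
  rw [Finset.mul_sum]
  calc ∑ m : List.Vector (Fin P.N) r with K < P.bits m.toList, K * P.prob ψ m.toList
      ≤ ∑ m : List.Vector (Fin P.N) r with K < P.bits m.toList,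
          P.prob ψ m.toList * P.bits m.toList := by
        refine Finset.sum_le_sum fun m hm => ?_
        rw [mul_comm]
        exact mul_le_mul_of_nonneg_left (Finset.mem_filter.1 hm).2.le (P.prob_nonneg ψ _)
    _ ≤ _ := Finset.sum_le_univ_sum_of_nonneg fun m =>
        mul_nonneg (P.prob_nonneg ψ _) (P.bits_nonneg _)

/-- A protocol of zero expected cost almost surely sends no bits. -/
theorem sum_prob_eq_zero_of_expectedCost (P : Protocol A B C r) (ψ : R × B × C × A → ℂ)
    (h : P.expectedCost ψ = 0) :
    ∑ m : List.Vector (Fin P.N) r with 0 < P.bits m.toList, P.prob ψ m.toList = 0 := by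
  refine Finset.sum_eq_zero fun m hm => ?_
  have := (Finset.sum_eq_zero_iff_of_nonneg fun m _ =>
    mul_nonneg (P.prob_nonneg ψ _) (P.bits_nonneg _)).1 h m (Finset.mem_univ m)
  exact (mul_eq_zero.1 this).resolve_right (Finset.mem_filter.1 hm).2.ne'

/-- A contraction of the reference register commutes with the protocol. -/
theorem applyRef_run (P : Protocol A B C r) {T : Matrix R R ℂ} {s : ℂ}
    {ψ φ : R × B × C × A → ℂ} (hT : applyRef T ψ = s • φ) (h : List (Fin P.N)) :
    applyRef T (P.run ψ h) = s • P.run φ h := by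
  induction h with
  | nil =>
    funext ⟨x, ⟨a, c, ea⟩, ⟨b, eb⟩⟩
    have := congr_fun hT (x, b, c, a)
    simp only [applyRef, Pi.smul_apply, smul_eq_mul] at this
    simp only [applyRef, run, initial, Pi.smul_apply, smul_eq_mul, ← mul_assoc, ← this,
      Finset.sum_mul]
  | cons i h ih =>
    by_cases hh : Even h.length
    · simp only [run, hh, if_true, applyRef_applyMid, ih, applyMid_smul]
    · simp only [run, hh, if_false, applyRef_applyLast, ih, applyLast_smul]

theorem applyRef_final (P : Protocol A B C r) {T : Matrix R R ℂ} {s : ℂ}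
    {ψ φ : R × B × C × A → ℂ} (hT : applyRef T ψ = s • φ) (m : List.Vector (Fin P.N) r) :
    applyRef T (P.final ψ m) = s • P.final φ m := by
  rw [final, applyRef_applyLast, applyRef_applyMid, P.applyRef_run hT, applyMid_smul,
    applyLast_smul, final]

/-! ### The output state -/

/-- The component of the final state on `R B C₀ A` along a transcript and basis states of the
registers that are traced out. -/
noncomputable def branch (P : Protocol A B C r) (ψ : R × B × C × A → ℂ)
    (i : List.Vector (Fin P.N) r × C × Fin P.dimEA × Fin P.dimTB) : R × B × C × A → ℂ :=
  fun z => P.final ψ i.1 (z.1, (z.2.2.2, i.2.1, i.2.2.1), (z.2.1, z.2.2.1, i.2.2.2))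

theorem output_eq_sum (P : Protocol A B C r) (ψ : R × B × C × A → ℂ) :
    P.output ψ = ∑ i, pureState (P.branch ψ i) := by
  ext ⟨x, b, c₀, a⟩ ⟨x', b', c₀', a'⟩
  simp only [Matrix.sum_apply, Fintype.sum_prod_type]
  rfl

theorem output_nonneg (P : Protocol A B C r) (ψ : R × B × C × A → ℂ) : 0 ≤ P.output ψ := by
  rw [output_eq_sum]
  exact Finset.sum_nonneg fun i _ => pureState_nonneg _

/-- The output is a sum of unnormalized pure states, one per transcript and basis state of the
traced-out registers, so its overlap with `ψ` is additive over branches. -/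
theorem overlap_output (P : Protocol A B C r) (ψ : R × B × C × A → ℂ) :
    (star ψ ⬝ᵥ P.output ψ *ᵥ ψ).re = ∑ i, ‖star ψ ⬝ᵥ P.branch ψ i‖ ^ 2 := by
  rw [output_eq_sum, Matrix.sum_mulVec, dotProduct_sum, Complex.re_sum]
  refine Finset.sum_congr rfl fun i _ => ?_
  rw [pureState, Matrix.vecMulVec_mulVec, dotProduct_smul, MulOpposite.smul_eq_mul_unop,
    MulOpposite.unop_op]
  have h : star (P.branch ψ i) ⬝ᵥ ψ = star (star ψ ⬝ᵥ P.branch ψ i) := by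
    rw [Matrix.star_dotProduct]
  rw [h, RCLike.star_def, Complex.mul_conj']
  norm_cast

theorem sum_norm_sq_branch (P : Protocol A B C r) (ψ : R × B × C × A → ℂ)
    (S : Finset (List.Vector (Fin P.N) r)) :
    ∑ i ∈ S ×ˢ Finset.univ, ∑ z, ‖P.branch ψ i z‖ ^ 2 = ∑ m ∈ S, P.prob ψ m.toList := by
  rw [Finset.sum_product]
  refine Finset.sum_congr rfl fun m _ => ?_
  rw [← sum_norm_sq_final]
  let f : (R × (A × C × Fin P.dimEA) × (B × C × Fin P.dimTB)) ≃
      (C × Fin P.dimEA × Fin P.dimTB) × (R × B × C × A) :=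
    ⟨fun z => ((z.2.1.2.1, z.2.1.2.2, z.2.2.2.2), (z.1, z.2.2.1, z.2.2.2.1, z.2.1.1)),
      fun w => (w.2.1, (w.2.2.2.2, w.1.1, w.1.2.1), (w.2.2.1, w.2.2.2.1, w.1.2.2)),
      fun _ => rfl, fun _ => rfl⟩
  rw [← f.symm.sum_comp]
  exact (Fintype.sum_prod_type fun w => ‖P.final ψ m (f.symm w)‖ ^ 2).symm

theorem redistributes_iff (P : Protocol A B C r) {ψ : R × B × C × A → ℂ}
    (hψ : ∑ z, ‖ψ z‖ ^ 2 = 1) {ε : ℝ} :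
    P.Redistributes ψ ε ↔ 0 ≤ ε ∧ 1 - ε ^ 2 ≤ ∑ i, ‖star ψ ⬝ᵥ P.branch ψ i‖ ^ 2 := by
  rw [Redistributes, purifiedDistance_pureState (P.output_nonneg ψ) hψ, overlap_output,
    Real.sqrt_le_iff]
  exact and_congr_right fun _ => ⟨fun h => by linarith, fun h => by linarith⟩

end Protocol

/-! ### Truncating a protocol -/

/-- Splits a counter off an ancilla register. -/
def counterEquiv (X : Type*) (k r : ℕ) : X × Fin (k * (r + 1)) ≃ (X × Fin k) × Fin (r + 1) :=
  (Equiv.prodCongr (Equiv.refl X) finProdFinEquiv.symm).trans (Equiv.prodAssoc _ _ _).symm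

/-- Splits a counter off an ancilla register that stands next to two other registers. -/
def counterEquiv₂ (X Y : Type*) (k r : ℕ) :
    X × Y × Fin (k * (r + 1)) ≃ (X × Y × Fin k) × Fin (r + 1) :=
  (Equiv.prodCongr (Equiv.refl X) (counterEquiv Y k r)).trans (Equiv.prodAssoc _ _ _).symm

/-- A state shared by two ancillas, together with a counter at zero on each side. -/
noncomputable def resetCounters {k l : ℕ} (r : ℕ) (θ : Fin k × Fin l → ℂ) :
    Fin (k * (r + 1)) × Fin (l * (r + 1)) → ℂ :=
  fun x =>
    if (finProdFinEquiv.symm x.1).2 = 0 ∧ (finProdFinEquiv.symm x.2).2 = 0 then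
      θ ((finProdFinEquiv.symm x.1).1, (finProdFinEquiv.symm x.2).1)
    else 0

theorem resetCounters_apply {k l : ℕ} (r : ℕ) (θ : Fin k × Fin l → ℂ) (x : Fin k) (y : Fin l)
    (c c' : Fin (r + 1)) :
    resetCounters r θ (finProdFinEquiv (x, c), finProdFinEquiv (y, c'))
      = if c = 0 ∧ c' = 0 then θ (x, y) else 0 := by
  simp only [resetCounters, Equiv.symm_apply_apply]

theorem sum_norm_sq_resetCounters {k l : ℕ} (r : ℕ) (θ : Fin k × Fin l → ℂ) :
    ∑ x, ‖resetCounters r θ x‖ ^ 2 = ∑ x, ‖θ x‖ ^ 2 := by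
  rw [← (Equiv.prodCongr finProdFinEquiv finProdFinEquiv).sum_comp]
  simp only [Fintype.sum_prod_type, Equiv.prodCongr_apply, Prod.map_apply, resetCounters_apply]
  refine Finset.sum_congr rfl fun x _ => ?_
  rw [Finset.sum_eq_single 0 (fun c _ hc => by simp [hc]) (by simp)]
  refine Finset.sum_congr rfl fun y _ => ?_
  rw [Finset.sum_eq_single 0 (fun c _ hc => by simp [hc]) (by simp)]
  simp

/-- Changes of coordinates on the second and third register. -/
def relabel {R X X' Y Y' : Type*} (f : X ≃ X') (g : Y ≃ Y') (Φ : R × X × Y → ℂ) :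
    R × X' × Y' → ℂ :=
  fun z => Φ (z.1, f.symm z.2.1, g.symm z.2.2)

section Relabel

variable {R X X' Y Y' X₁ X₁' Y₁ Y₁' : Type*} [Fintype X] [Fintype X'] [Fintype Y] [Fintype Y']

theorem relabel_applyMid (f : X ≃ X') (f₁ : X₁ ≃ X₁') (g : Y ≃ Y') (M : Matrix X₁' X' ℂ)
    (Φ : R × X × Y → ℂ) :
    relabel f₁ g (applyMid (M.submatrix f₁ f) Φ) = applyMid M (relabel f g Φ) := by
  funext z
  simp only [relabel, applyMid, Matrix.submatrix_apply, Equiv.apply_symm_apply]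
  exact Fintype.sum_equiv f _ _ fun x => by rw [Equiv.symm_apply_apply]

theorem relabel_applyLast (f : X ≃ X') (g : Y ≃ Y') (g₁ : Y₁ ≃ Y₁') (M : Matrix Y₁' Y' ℂ)
    (Φ : R × X × Y → ℂ) :
    relabel f g₁ (applyLast (M.submatrix g₁ g) Φ) = applyLast M (relabel f g Φ) := by
  funext z
  simp only [relabel, applyLast, Matrix.submatrix_apply, Equiv.apply_symm_apply]
  exact Fintype.sum_equiv g _ _ fun x => by rw [Equiv.symm_apply_apply]

end Relabel

/-! ### The truncated protocol and its comparison with the original -/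

namespace Protocol

variable {R A B C : Type*} [Fintype R] [Fintype A] [Fintype B] [Fintype C]
  [DecidableEq R] [DecidableEq A] [DecidableEq B] [DecidableEq C] {r : ℕ}

/-- The messages other than `i₀` that would lead to more than `K` bits after the history `h`. -/
noncomputable def overflow (P : Protocol A B C r) (i₀ : Fin P.N) (K : ℝ) (h : List (Fin P.N)) :
    Finset (Fin P.N) :=
  {i | i ≠ i₀ ∧ K < P.bits (i :: h)}

theorem notMem_overflow (P : Protocol A B C r) (i₀ : Fin P.N) (K : ℝ) (h : List (Fin P.N)) :
    i₀ ∉ P.overflow i₀ K h := by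
  simp [overflow]

/-- The product of the unitaries by which Alice counts merged outcomes. -/
noncomputable def counterA (P : Protocol A B C r) (i₀ : Fin P.N) (K : ℝ) : List (Fin P.N) →
    Matrix ((A × C × Fin P.dimEA) × Fin (r + 1)) ((A × C × Fin P.dimEA) × Fin (r + 1)) ℂ
  | [] => 1
  | _ :: h =>
      if Even h.length then
        countUnitary (∑ j ∈ P.overflow i₀ K h, P.measA h j) r * P.counterA i₀ K h
      else P.counterA i₀ K h

/-- The product of the unitaries by which Bob counts merged outcomes. -/
noncomputable def counterB (P : Protocol A B C r) (i₀ : Fin P.N) (K : ℝ) : List (Fin P.N) →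
    Matrix ((B × Fin P.dimEB) × Fin (r + 1)) ((B × Fin P.dimEB) × Fin (r + 1)) ℂ
  | [] => 1
  | _ :: h =>
      if Even h.length then P.counterB i₀ K h
      else countUnitary (∑ j ∈ P.overflow i₀ K h, P.measB h j) r * P.counterB i₀ K h

theorem isUnitaryMap_counterA (P : Protocol A B C r) (i₀ : Fin P.N) (K : ℝ)
    (h : List (Fin P.N)) : IsUnitaryMap (P.counterA i₀ K h) := by
  induction h with
  | nil => exact isUnitaryMap_one
  | cons i h ih =>
    rw [counterA]
    split_ifs
    · exact (isUnitaryMap_countUnitary ((P.measA_proj h).isStarProjection_sum _) r).mul ih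
    · exact ih

theorem isUnitaryMap_counterB (P : Protocol A B C r) (i₀ : Fin P.N) (K : ℝ)
    (h : List (Fin P.N)) : IsUnitaryMap (P.counterB i₀ K h) := by
  induction h with
  | nil => exact isUnitaryMap_one
  | cons i h ih =>
    rw [counterB]
    split_ifs
    · exact ih
    · exact (isUnitaryMap_countUnitary ((P.measB_proj h).isStarProjection_sum _) r).mul ih

variable (P : Protocol A B C r) (i₀ : Fin P.N) (K : ℝ)

/-- Alice's measurement in the truncated protocol, with the counter as a separate register. -/
noncomputable def countedMeasA (h : List (Fin P.N)) (i : Fin P.N) :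
    Matrix ((A × C × Fin P.dimEA) × Fin (r + 1)) ((A × C × Fin P.dimEA) × Fin (r + 1)) ℂ :=
  -- A protocol has no unitaries between measurements. Counting is therefore deferred: later
  -- measurements are conjugated by the accumulated counting unitary, which is finally absorbed into
  -- the last unitary.
  (P.counterA i₀ K h)ᴴ * (mergeOutcomes (P.measA h) i₀ (P.overflow i₀ K h) i ⊗ₖ 1) *
    P.counterA i₀ K h

/-- Bob's measurement in the truncated protocol, with the counter as a separate register. -/
noncomputable def countedMeasB (h : List (Fin P.N)) (i : Fin P.N) :
    Matrix ((B × Fin P.dimEB) × Fin (r + 1)) ((B × Fin P.dimEB) × Fin (r + 1)) ℂ :=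
  (P.counterB i₀ K h)ᴴ * (mergeOutcomes (P.measB h) i₀ (P.overflow i₀ K h) i ⊗ₖ 1) *
    P.counterB i₀ K h

/-- Alice's final unitary in the truncated protocol, with the counter as a separate register. -/
noncomputable def countedFinalA (m : List.Vector (Fin P.N) r) :
    Matrix ((A × C × Fin P.dimEA) × Fin (r + 1)) ((A × C × Fin P.dimEA) × Fin (r + 1)) ℂ :=
  (P.finalA m ⊗ₖ (1 : Matrix (Fin (r + 1)) (Fin (r + 1)) ℂ)) * P.counterA i₀ K m.toList

/-- Bob's final unitary in the truncated protocol, with the counter as a separate register. -/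
noncomputable def countedFinalB (m : List.Vector (Fin P.N) r) :
    Matrix ((B × C × Fin P.dimTB) × Fin (r + 1)) ((B × Fin P.dimEB) × Fin (r + 1)) ℂ :=
  (P.finalB m ⊗ₖ (1 : Matrix (Fin (r + 1)) (Fin (r + 1)) ℂ)) * P.counterB i₀ K m.toList

theorem isProjectiveMeasurement_countedMeasA (h : List (Fin P.N)) :
    IsProjectiveMeasurement (P.countedMeasA i₀ K h) :=
  ((P.measA_proj h).mergeOutcomes
    (P.notMem_overflow i₀ K h)).kronecker_one.conj (P.isUnitaryMap_counterA i₀ K h)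

theorem isProjectiveMeasurement_countedMeasB (h : List (Fin P.N)) :
    IsProjectiveMeasurement (P.countedMeasB i₀ K h) :=
  ((P.measB_proj h).mergeOutcomes
    (P.notMem_overflow i₀ K h)).kronecker_one.conj (P.isUnitaryMap_counterB i₀ K h)

theorem isUnitaryMap_countedFinalA (m : List.Vector (Fin P.N) r) :
    IsUnitaryMap (P.countedFinalA i₀ K m) :=
  (P.finalA_unitary m).kronecker_one.mul (P.isUnitaryMap_counterA i₀ K m.toList)

theorem isUnitaryMap_countedFinalB (m : List.Vector (Fin P.N) r) :
    IsUnitaryMap (P.countedFinalB i₀ K m) :=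
  (P.finalB_unitary m).kronecker_one.mul (P.isUnitaryMap_counterB i₀ K m.toList)

/-- The protocol in which the messages that would exceed `K` bits are merged into the message
`i₀`. Alice and Bob count how often this has happened in ancillas with `r + 1` values. -/
noncomputable def truncate : Protocol A B C r where
  N := P.N
  dimEA := P.dimEA * (r + 1)
  dimEB := P.dimEB * (r + 1)
  dimTB := P.dimTB * (r + 1)
  θ := resetCounters r P.θ
  θ_norm := (sum_norm_sq_resetCounters r P.θ).trans P.θ_norm
  measA h i := (P.countedMeasA i₀ K h i).submatrix
    (counterEquiv₂ A C P.dimEA r) (counterEquiv₂ A C P.dimEA r)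
  measA_proj h := (P.isProjectiveMeasurement_countedMeasA i₀ K h).submatrix _
  measB h i := (P.countedMeasB i₀ K h i).submatrix
    (counterEquiv B P.dimEB r) (counterEquiv B P.dimEB r)
  measB_proj h := (P.isProjectiveMeasurement_countedMeasB i₀ K h).submatrix _
  finalA m := (P.countedFinalA i₀ K m).submatrix
    (counterEquiv₂ A C P.dimEA r) (counterEquiv₂ A C P.dimEA r)
  finalA_unitary m := (P.isUnitaryMap_countedFinalA i₀ K m).submatrix _ _
  finalB m := (P.countedFinalB i₀ K m).submatrix
    (counterEquiv₂ B C P.dimTB r) (counterEquiv B P.dimEB r)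
  finalB_unitary m := (P.isUnitaryMap_countedFinalB i₀ K m).submatrix _ _

/-- The state of the truncated protocol, with the counters as separate registers. -/
noncomputable def truncateRun (ψ : R × B × C × A → ℂ) (h : List (Fin P.N)) :
    R × ((A × C × Fin P.dimEA) × Fin (r + 1)) × ((B × Fin P.dimEB) × Fin (r + 1)) → ℂ :=
  relabel (counterEquiv₂ A C P.dimEA r) (counterEquiv B P.dimEB r) ((P.truncate i₀ K).run ψ h)

theorem truncateRun_nil (ψ : R × B × C × A → ℂ) (x : R) (y : A × C × Fin P.dimEA)
    (z : B × Fin P.dimEB) (c c' : Fin (r + 1)) :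
    P.truncateRun i₀ K ψ [] (x, (y, c), (z, c'))
      = if c = 0 ∧ c' = 0 then P.initial ψ (x, y, z) else 0 := by
  obtain ⟨a, cc, ea⟩ := y
  obtain ⟨b, eb⟩ := z
  have h : P.truncateRun i₀ K ψ [] (x, ((a, cc, ea), c), ((b, eb), c'))
      = ψ (x, b, cc, a) *
        resetCounters r P.θ (finProdFinEquiv (ea, c), finProdFinEquiv (eb, c')) := rfl
  rw [h, resetCounters_apply, mul_ite, mul_zero]
  rfl

theorem truncateRun_cons_even (ψ : R × B × C × A → ℂ) (i : Fin P.N) {h : List (Fin P.N)}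
    (hh : Even h.length) :
    P.truncateRun i₀ K ψ (i :: h)
      = applyMid (P.countedMeasA i₀ K h i) (P.truncateRun i₀ K ψ h) :=
  (congrArg (relabel (counterEquiv₂ A C P.dimEA r) (counterEquiv B P.dimEB r)) (if_pos hh)).trans
    (relabel_applyMid _ _ _ _ _)

theorem truncateRun_cons_odd (ψ : R × B × C × A → ℂ) (i : Fin P.N) {h : List (Fin P.N)}
    (hh : ¬ Even h.length) :
    P.truncateRun i₀ K ψ (i :: h)
      = applyLast (P.countedMeasB i₀ K h i) (P.truncateRun i₀ K ψ h) :=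
  (congrArg (relabel (counterEquiv₂ A C P.dimEA r) (counterEquiv B P.dimEB r)) (if_neg hh)).trans
    (relabel_applyLast _ _ _ _ _)

theorem relabel_final_truncate (ψ : R × B × C × A → ℂ) (m : List.Vector (Fin P.N) r) :
    relabel (counterEquiv₂ A C P.dimEA r) (counterEquiv₂ B C P.dimTB r)
        ((P.truncate i₀ K).final ψ m)
      = applyLast (P.countedFinalB i₀ K m)
          (applyMid (P.countedFinalA i₀ K m) (P.truncateRun i₀ K ψ m.toList)) :=
  (relabel_applyLast (counterEquiv₂ A C P.dimEA r) (counterEquiv B P.dimEB r) _ _ _).trans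
    (congrArg _ (relabel_applyMid _ _ _ _ _))

/-- The state of the truncated protocol after undoing the change of basis in its measurements. -/
noncomputable def countedRun (ψ : R × B × C × A → ℂ) (h : List (Fin P.N)) :
    R × ((A × C × Fin P.dimEA) × Fin (r + 1)) × ((B × Fin P.dimEB) × Fin (r + 1)) → ℂ :=
  applyLast (P.counterB i₀ K h) (applyMid (P.counterA i₀ K h) (P.truncateRun i₀ K ψ h))

theorem countedRun_nil (ψ : R × B × C × A → ℂ) :
    P.countedRun i₀ K ψ [] = P.truncateRun i₀ K ψ [] := by
  rw [countedRun, counterA, counterB, applyMid_one, applyLast_one]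

/-- The accumulated unitary cancels against its adjoint in the conjugated measurement, leaving the
merged measurement followed by one new counting step. -/
theorem countedRun_cons_even (ψ : R × B × C × A → ℂ) (i : Fin P.N) {h : List (Fin P.N)}
    (hh : Even h.length) :
    P.countedRun i₀ K ψ (i :: h) = applyMid
      ((if i ∈ P.overflow i₀ K h then 0 else P.measA h i) ⊗ₖ 1
        + (if i = i₀ then ∑ j ∈ P.overflow i₀ K h, P.measA h j else 0) ⊗ₖ counterShift r)
      (P.countedRun i₀ K ψ h) := by
  rw [countedRun, countedRun, counterA, counterB, if_pos hh, if_pos hh,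
    P.truncateRun_cons_even i₀ K ψ i hh, countedMeasA,
    ← countUnitary_mul_mergeOutcomes (P.measA_proj h) (P.notMem_overflow i₀ K h),
    applyMid_applyLast, applyMid_applyMid, applyMid_applyMid]
  congr 2
  simp only [Matrix.mul_assoc]
  rw [← Matrix.mul_assoc (P.counterA i₀ K h), (P.isUnitaryMap_counterA i₀ K h).2, Matrix.one_mul]

theorem countedRun_cons_odd (ψ : R × B × C × A → ℂ) (i : Fin P.N) {h : List (Fin P.N)}
    (hh : ¬ Even h.length) :
    P.countedRun i₀ K ψ (i :: h) = applyLast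
      ((if i ∈ P.overflow i₀ K h then 0 else P.measB h i) ⊗ₖ 1
        + (if i = i₀ then ∑ j ∈ P.overflow i₀ K h, P.measB h j else 0) ⊗ₖ counterShift r)
      (P.countedRun i₀ K ψ h) := by
  rw [countedRun, countedRun, counterA, counterB, if_neg hh, if_neg hh,
    P.truncateRun_cons_odd i₀ K ψ i hh, countedMeasB,
    ← countUnitary_mul_mergeOutcomes (P.measB_proj h) (P.notMem_overflow i₀ K h),
    applyMid_applyLast, applyLast_applyLast, applyLast_applyLast]
  congr 1
  simp only [Matrix.mul_assoc]
  rw [← Matrix.mul_assoc (P.counterB i₀ K h), (P.isUnitaryMap_counterB i₀ K h).2, Matrix.one_mul]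

/-- Each round raises at most one of the counters, by at most one, so neither can exceed the number
of rounds played. -/
theorem countedRun_eq_zero (ψ : R × B × C × A → ℂ) (h : List (Fin P.N)) (x : R)
    (y : A × C × Fin P.dimEA) (z : B × Fin P.dimEB) {c c' : Fin (r + 1)}
    (hc : h.length < c.val ∨ h.length < c'.val) :
    P.countedRun i₀ K ψ h (x, (y, c), (z, c')) = 0 := by
  -- The subtraction is cyclic, but `b` is nonzero here and does not wrap around.
  have pred : ∀ {b : Fin (r + 1)} {k : ℕ}, k + 1 < b.val → k < (b - 1).val := fun {b k} hb => by
    have hb0 : b ≠ 0 := fun h0 => by simp [h0] at hb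
    rw [Fin.val_sub_one_of_ne_zero hb0]
    omega
  induction h generalizing y z c c' with
  | nil =>
    rw [countedRun_nil, truncateRun_nil, if_neg]
    rintro ⟨rfl, rfl⟩
    simp at hc
  | cons i h ih =>
    rw [List.length_cons] at hc
    by_cases hh : Even h.length
    · rw [countedRun_cons_even P i₀ K ψ i hh, applyMid_apply, kronecker_counter_mulVec]
      have e1 : (fun y' => P.countedRun i₀ K ψ h (x, (y', c), (z, c'))) = 0 :=
        funext fun y' => ih y' z (by omega)
      have e2 : (fun y' => P.countedRun i₀ K ψ h (x, (y', c - 1), (z, c'))) = 0 :=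
        funext fun y' => ih y' z (hc.imp pred (by omega))
      rw [e1, e2, Matrix.mulVec_zero, Matrix.mulVec_zero]
      simp
    · rw [countedRun_cons_odd P i₀ K ψ i hh, applyLast_apply, kronecker_counter_mulVec]
      have e1 : (fun z' => P.countedRun i₀ K ψ h (x, (y, c), (z', c'))) = 0 :=
        funext fun z' => ih y z' (by omega)
      have e2 : (fun z' => P.countedRun i₀ K ψ h (x, (y, c), (z', c' - 1))) = 0 :=
        funext fun z' => ih y z' (hc.imp (by omega) pred)
      rw [e1, e2, Matrix.mulVec_zero, Matrix.mulVec_zero]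
      simp

/-- Along transcripts of at most `K` bits, the truncated protocol agrees with the original one on
the part of the state where both counters vanish. -/
theorem countedRun_eq_run (ψ : R × B × C × A → ℂ) {h : List (Fin P.N)} (hr : h.length ≤ r)
    (hK : P.bits h ≤ K) (x : R) (y : A × C × Fin P.dimEA) (z : B × Fin P.dimEB) :
    P.countedRun i₀ K ψ h (x, (y, 0), (z, 0)) = P.run ψ h (x, y, z) := by
  -- Counter value zero could only be re-entered from value `r`. Before a round the history is
  -- shorter than `r`, so that component is still zero; this is why `r + 1` values suffice.
  have last : ((0 : Fin (r + 1)) - 1).val = r := by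
    rw [zero_sub, Fin.coe_neg_one]
  induction h generalizing y z with
  | nil => simp [countedRun_nil, truncateRun_nil, run]
  | cons i h ih =>
    have hlen : h.length < r := by rw [List.length_cons] at hr; omega
    have ih' := ih hlen.le ((P.bits_le_bits_cons i h).trans hK)
    have hi : i ∉ P.overflow i₀ K h := by simp [overflow, hK]
    by_cases hh : Even h.length
    · rw [countedRun_cons_even P i₀ K ψ i hh, applyMid_apply, kronecker_counter_mulVec, if_neg hi]
      have e2 : (fun y' => P.countedRun i₀ K ψ h (x, (y', 0 - 1), (z, 0))) = 0 :=
        funext fun y' => P.countedRun_eq_zero i₀ K ψ h x y' z (.inl (by rw [last]; exact hlen))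
      rw [e2, Matrix.mulVec_zero, run, if_pos hh, applyMid_apply]
      simp [ih']
    · rw [countedRun_cons_odd P i₀ K ψ i hh, applyLast_apply, kronecker_counter_mulVec, if_neg hi]
      have e2 : (fun z' => P.countedRun i₀ K ψ h (x, (y, 0), (z', 0 - 1))) = 0 :=
        funext fun z' => P.countedRun_eq_zero i₀ K ψ h x y z' (.inr (by rw [last]; exact hlen))
      rw [e2, Matrix.mulVec_zero, run, if_neg hh, applyLast_apply]
      simp [ih']

theorem relabel_final_truncate_apply (ψ : R × B × C × A → ℂ) {m : List.Vector (Fin P.N) r}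
    (hK : P.bits m.toList ≤ K) (x : R) (y : A × C × Fin P.dimEA) (z : B × C × Fin P.dimTB) :
    relabel (counterEquiv₂ A C P.dimEA r) (counterEquiv₂ B C P.dimTB r)
      ((P.truncate i₀ K).final ψ m) (x, (y, 0), (z, 0)) = P.final ψ m (x, y, z) := by
  rw [relabel_final_truncate, countedFinalA, countedFinalB, ← applyMid_applyMid,
    ← applyLast_applyLast, ← applyMid_applyLast (P.finalA m ⊗ₖ 1), ← countedRun, applyLast_apply,
    kronecker_one_mulVec, final, applyLast_apply]
  congr 2
  funext z'
  rw [applyMid_apply, kronecker_one_mulVec, applyMid_apply]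
  congr 2
  funext y'
  exact P.countedRun_eq_run i₀ K ψ (by simp) hK x y' z'

theorem branch_truncate (ψ : R × B × C × A → ℂ) {m : List.Vector (Fin P.N) r}
    (hK : P.bits m.toList ≤ K) (c : C) (ea : Fin P.dimEA) (tb : Fin P.dimTB) :
    (P.truncate i₀ K).branch ψ (m, c, finProdFinEquiv (ea, 0), finProdFinEquiv (tb, 0))
      = P.branch ψ (m, c, ea, tb) := by
  funext ⟨x, b, c₀, a⟩
  exact P.relabel_final_truncate_apply i₀ K ψ hK x (a, c, ea) (b, c₀, tb)

/-- Short branches of the original protocol occur among the branches of the truncated one as those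
with both traced-out counters at zero. All further terms are nonnegative. -/
theorem sum_overlap_truncate_ge (ψ : R × B × C × A → ℂ) :
    ∑ i ∈ ({m | P.bits m.toList ≤ K} : Finset (List.Vector (Fin P.N) r)) ×ˢ Finset.univ,
        ‖star ψ ⬝ᵥ P.branch ψ i‖ ^ 2
      ≤ ∑ i, ‖star ψ ⬝ᵥ (P.truncate i₀ K).branch ψ i‖ ^ 2 := by
  let g : List.Vector (Fin P.N) r × C × Fin P.dimEA × Fin P.dimTB →
      List.Vector (Fin P.N) r × C × Fin (P.dimEA * (r + 1)) × Fin (P.dimTB * (r + 1)) :=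
    fun i => (i.1, i.2.1, finProdFinEquiv (i.2.2.1, 0), finProdFinEquiv (i.2.2.2, 0))
  have hg : Function.Injective g := by
    rintro ⟨m, c, ea, tb⟩ ⟨m', c', ea', tb'⟩ h
    simpa [g] using h
  calc _ = ∑ i ∈ (({m | P.bits m.toList ≤ K} : Finset (List.Vector (Fin P.N) r)) ×ˢ
          Finset.univ).map ⟨g, hg⟩, ‖star ψ ⬝ᵥ (P.truncate i₀ K).branch ψ i‖ ^ 2 := by
        rw [Finset.sum_map]
        refine Finset.sum_congr rfl fun i hi => ?_
        have hK : P.bits i.1.toList ≤ K := by simpa using hi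
        obtain ⟨m, c, ea, tb⟩ := i
        rw [← P.branch_truncate i₀ K ψ hK]
        rfl
    _ ≤ _ := Finset.sum_le_univ_sum_of_nonneg fun i => by positivity

/-- An overflow message has zero projection in the truncated protocol, and `i₀`, which stands for
the integer 1, adds no bits. Hence no possible history ever passes `K`. -/
theorem worstCaseCostLE_truncate (hi₀ : i₀.val = 0) (hK : 0 ≤ K) :
    (P.truncate i₀ K).WorstCaseCostLE K := by
  have key : ∀ h : List (Fin P.N), (P.truncate i₀ K).Possible h → P.bits h ≤ K := fun h => by
    induction h with
    | nil => intro _; rwa [bits_nil]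
    | cons i h ih =>
      rintro ⟨hp, hi⟩
      by_contra! hlt
      have hne : i ≠ i₀ := by
        rintro rfl
        rw [bits_cons, hi₀] at hlt
        have := ih hp
        simp at hlt
        linarith
      have hmem : i ∈ P.overflow i₀ K h := by simp [overflow, hne, hlt]
      simp [truncate, countedMeasA, countedMeasB, mergeOutcomes, hmem] at hi
      split_ifs at hi <;> exact hi rfl
  exact fun (m : List.Vector (Fin P.N) r) hm => key m.toList hm

end Protocol

/-! ### From expected to worst case cost -/

theorem sum_norm_sq_applyRef_le {R Y : Type*} [Fintype R] [Fintype Y] {T : Matrix R R ℂ}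
    (hT : ∀ y : R → ℂ, ∑ x, ‖(T *ᵥ y) x‖ ^ 2 ≤ ∑ x, ‖y x‖ ^ 2) (Φ : R × Y → ℂ) :
    ∑ z, ‖applyRef T Φ z‖ ^ 2 ≤ ∑ z, ‖Φ z‖ ^ 2 := by
  rw [Fintype.sum_prod_type_right, Fintype.sum_prod_type_right]
  exact Finset.sum_le_sum fun y _ => hT fun x => Φ (x, y)

/-- A contraction of the reference register as a linear map on states. -/
noncomputable def applyRefLinear {R Y : Type*} [Fintype R] [Fintype Y] (T : Matrix R R ℂ) :
    EuclideanSpace ℂ (R × Y) →ₗ[ℂ] EuclideanSpace ℂ (R × Y) where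
  toFun Φ := WithLp.toLp 2 (applyRef T Φ)
  map_add' Φ Φ' := by
    ext z
    simp [applyRef, mul_add, Finset.sum_add_distrib]
  map_smul' c Φ := by
    ext z
    simp [applyRef, Finset.mul_sum, mul_left_comm]

namespace Protocol

variable {R A B C : Type*} [Fintype R] [Fintype A] [Fintype B] [Fintype C]
  [DecidableEq R] [DecidableEq A] [DecidableEq B] [DecidableEq C] {r : ℕ}

/-- Supplies the message `i₀`. Without messages the empty sum of projections would be the identity
on a space that is nonzero because `ψ` and `θ` are. -/
theorem N_pos (P : Protocol A B C r) {ψ : R × B × C × A → ℂ} (hψ : ∑ z, ‖ψ z‖ ^ 2 = 1) :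
    0 < P.N := by
  by_contra! hN
  have : IsEmpty (Fin P.N) := by
    rw [Nat.le_zero.1 hN]
    infer_instance
  obtain ⟨⟨-, -, c, a⟩, -⟩ := Finset.exists_ne_zero_of_sum_ne_zero (hψ.trans_ne one_ne_zero)
  obtain ⟨⟨ea, -⟩, -⟩ := Finset.exists_ne_zero_of_sum_ne_zero (P.θ_norm.trans_ne one_ne_zero)
  have h := congr_fun (congr_fun (P.measA_proj []).2 (a, c, ea)) (a, c, ea)
  simp at h

theorem applyRef_branch (P : Protocol A B C r) {T : Matrix R R ℂ} {s : ℂ}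
    {ψ φ : R × B × C × A → ℂ} (hT : applyRef T ψ = s • φ)
    (i : List.Vector (Fin P.N) r × C × Fin P.dimEA × Fin P.dimTB) :
    applyRef T (P.branch ψ i) = s • P.branch φ i := by
  funext z
  exact congr_fun (P.applyRef_final hT i.1)
    (z.1, (z.2.2.2, i.2.1, i.2.2.1), (z.2.1, z.2.2.1, i.2.2.2))

theorem sum_prob_exceed_le (P : Protocol A B C r) (ψ : R × B × C × A → ℂ) {E ν : ℝ} (hν : 0 < ν)
    (hE : P.expectedCost ψ ≤ E) :
    ∑ m : List.Vector (Fin P.N) r with E / ν < P.bits m.toList, P.prob ψ m.toList ≤ ν := by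
  -- If `E = 0` the threshold `E / ν` is zero and Markov's inequality says nothing, but zero
  -- expected cost forces all transcripts of positive length to have probability zero.
  rcases ((P.expectedCost_nonneg ψ).trans hE).eq_or_lt with h0 | hpos
  · have hz : P.expectedCost ψ = 0 := le_antisymm (h0 ▸ hE) (P.expectedCost_nonneg ψ)
    rw [← h0, zero_div, P.sum_prob_eq_zero_of_expectedCost ψ hz]
    exact hν.le
  · have h := (P.mul_sum_prob_le_expectedCost ψ (E / ν)).trans hE
    rwa [div_mul_eq_mul_div, div_le_iff₀ hν, mul_le_mul_iff_right₀ hpos] at h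

/-- The common core of redistribution and state transfer: nothing about the two states matters
except that a contraction of the reference maps `ψ` to `s • φ`. -/
theorem exists_worstCaseCostLE (P : Protocol A B C r) {ψ φ : R × B × C × A → ℂ}
    (hψ : ∑ z, ‖ψ z‖ ^ 2 = 1) (hφ : ∑ z, ‖φ z‖ ^ 2 = 1) {T : Matrix R R ℂ}
    (hT : ∀ y : R → ℂ, ∑ x, ‖(T *ᵥ y) x‖ ^ 2 ≤ ∑ x, ‖y x‖ ^ 2) {s : ℝ} (hs : 0 < s)
    (hTψ : applyRef T ψ = (s : ℂ) • φ) {ε E μ : ℝ} (hε : ε < 1) (hμ : 0 < μ)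
    (hP : P.Redistributes ψ ε) (hE : P.expectedCost ψ ≤ E) :
    ∃ P' : Protocol A B C r, P'.WorstCaseCostLE (2 * E / (μ * (1 - ε))) ∧
      P'.Redistributes φ (√(8 * ε / s ^ 2) + √μ) := by
  classical
  obtain ⟨hε0, hP⟩ := (P.redistributes_iff hψ).1 hP
  have hE0 : 0 ≤ E := (P.expectedCost_nonneg ψ).trans hE
  -- This is the Markov level `E / K`; twice it enters the overlap bound, as `μ * (1 - ε) ≤ μ`.
  have hν : 0 < μ * (1 - ε) / 2 := by
    have : 0 < 1 - ε := sub_pos.2 hε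
    positivity
  set K := 2 * E / (μ * (1 - ε)) with hKdef
  have hKν : K = E / (μ * (1 - ε) / 2) := by
    rw [hKdef, div_div_eq_mul_div, mul_comm]
  have hK : 0 ≤ K := hKν ▸ div_nonneg hE0 hν.le
  let i₀ : Fin P.N := ⟨0, P.N_pos hψ⟩
  refine ⟨P.truncate i₀ K, P.worstCaseCostLE_truncate i₀ K rfl hK, ?_⟩
  refine ((P.truncate i₀ K).redistributes_iff hφ).2 ⟨by positivity, ?_⟩
  refine le_trans ?_ (P.sum_overlap_truncate_ge i₀ K φ)
  let S : Finset (List.Vector (Fin P.N) r) := {m | K < P.bits m.toList}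
  have hcompl : (S ×ˢ (Finset.univ : Finset (C × Fin P.dimEA × Fin P.dimTB)))ᶜ
      = ({m | P.bits m.toList ≤ K} : Finset (List.Vector (Fin P.N) r)) ×ˢ Finset.univ := by
    ext i
    simp [S]
  have hnorm : ∀ χ : R × B × C × A → ℂ, ‖WithLp.toLp 2 χ‖ ^ 2 = ∑ z, ‖χ z‖ ^ 2 := fun χ =>
    EuclideanSpace.norm_sq_eq _
  have hinner : ∀ χ χ' : R × B × C × A → ℂ,
      inner ℂ (WithLp.toLp 2 χ) (WithLp.toLp 2 χ') = star χ ⬝ᵥ χ' := fun χ χ' => by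
    rw [EuclideanSpace.inner_toLp_toLp, dotProduct_comm]
  have hunit : ∀ {χ : R × B × C × A → ℂ}, ∑ z, ‖χ z‖ ^ 2 = 1 → ‖WithLp.toLp 2 χ‖ = 1 :=
    fun {χ} h => by rwa [← hnorm, pow_eq_one_iff_of_nonneg (norm_nonneg _) two_ne_zero] at h
  have htotal : ∀ {χ : R × B × C × A → ℂ}, ∑ z, ‖χ z‖ ^ 2 = 1 →
      ∑ i, ‖WithLp.toLp 2 (P.branch χ i)‖ ^ 2 = 1 := fun {χ} h => by
    simp_rw [hnorm]
    rw [← Finset.univ_product_univ, sum_norm_sq_branch, sum_prob, h]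
  have main := sum_compl_inner_sq_ge (hunit hψ) (hunit hφ) (applyRefLinear T)
    (fun x => by
      refine le_of_sq_le_sq ?_ (norm_nonneg _)
      rw [EuclideanSpace.norm_sq_eq, EuclideanSpace.norm_sq_eq]
      exact sum_norm_sq_applyRef_le hT _) hs
    (congrArg (WithLp.toLp 2) hTψ) (fun i => WithLp.toLp 2 (P.branch ψ i))
    (fun i => WithLp.toLp 2 (P.branch φ i))
    (fun i => congrArg (WithLp.toLp 2) (P.applyRef_branch hTψ i)) (htotal hψ) (htotal hφ)
    -- The purified distance from a pure state squares to one minus the overlap.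
    (δ := ε ^ 2) (by simpa only [hinner] using hP) (S ×ˢ Finset.univ)
  rw [hcompl] at main
  simp only [hinner, hnorm, sum_norm_sq_branch] at main
  refine le_trans ?_ main
  have hS : ∑ m ∈ S, P.prob ψ m.toList ≤ μ * (1 - ε) / 2 := by
    have := P.sum_prob_exceed_le ψ hν hE
    rwa [← hKν] at this
  have h1 : 3 * ε ^ 2 / s ^ 2 ≤ 8 * ε / s ^ 2 := by
    have : 3 * ε ^ 2 ≤ 8 * ε := by nlinarith
    gcongr
  have h2 : √(8 * ε / s ^ 2) ^ 2 = 8 * ε / s ^ 2 := Real.sq_sqrt (by positivity)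
  have h3 : √μ ^ 2 = μ := Real.sq_sqrt hμ.le
  have h4 : 0 ≤ √(8 * ε / s ^ 2) * √μ := by positivity
  -- Uses `x + μ ≤ (√x + √μ)²` for `x = 8 * ε / s ^ 2`, the cross term being nonnegative.
  nlinarith

end Protocol

/-! ### States in Schmidt form -/

section Schmidt

variable {d : ℕ} (u : OrthonormalBasis (Fin d) ℂ (EuclideanSpace ℂ (Fin d)))

theorem sum_norm_sq_combination (a : Fin d → ℂ) :
    ∑ x, ‖∑ j, a j * u j x‖ ^ 2 = ∑ j, ‖a j‖ ^ 2 := by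
  have h := u.sum_sq_norm_inner_right (∑ j, a j • u j)
  simp_rw [u.orthonormal.inner_right_fintype] at h
  rw [h, EuclideanSpace.norm_sq_eq]
  simp

theorem sum_norm_sq_basis (j : Fin d) : ∑ x, ‖u j x‖ ^ 2 = 1 := by
  rw [← EuclideanSpace.norm_sq_eq, u.norm_eq_one, one_pow]

theorem sum_star_mul_basis (i j : Fin d) :
    ∑ x, star (u i x) * u j x = if i = j then 1 else 0 := by
  rw [← u.inner_eq_ite i j, PiLp.inner_apply]
  exact Finset.sum_congr rfl fun x _ => mul_comm _ _

/-- The operator on the reference register that is diagonal in the basis `u`. -/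
noncomputable def diagonalRef (t : Fin d → ℂ) : Matrix (Fin d) (Fin d) ℂ :=
  Matrix.of fun x x' => ∑ j, t j * u j x * star (u j x')

theorem diagonalRef_mulVec (t y : Fin d → ℂ) (x : Fin d) :
    (diagonalRef u t *ᵥ y) x = ∑ j, (t j * ∑ x', star (u j x') * y x') * u j x := by
  simp only [diagonalRef, Matrix.mulVec, dotProduct, Matrix.of_apply, Finset.sum_mul,
    Finset.mul_sum]
  rw [Finset.sum_comm]
  exact Finset.sum_congr rfl fun _ _ => Finset.sum_congr rfl fun _ _ => by ring

theorem sum_norm_sq_diagonalRef_le {t : Fin d → ℂ} (ht : ∀ j, ‖t j‖ ≤ 1) (y : Fin d → ℂ) :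
    ∑ x, ‖(diagonalRef u t *ᵥ y) x‖ ^ 2 ≤ ∑ x, ‖y x‖ ^ 2 := by
  simp_rw [diagonalRef_mulVec]
  rw [sum_norm_sq_combination]
  have h := u.sum_sq_norm_inner_right (WithLp.toLp 2 y)
  rw [EuclideanSpace.norm_sq_eq] at h
  refine le_trans (Finset.sum_le_sum fun j _ => ?_) h.le
  have hin : inner ℂ (u j) (WithLp.toLp 2 y) = ∑ x', star (u j x') * y x' := by
    rw [PiLp.inner_apply]
    exact Finset.sum_congr rfl fun x _ => mul_comm _ _
  rw [norm_mul, hin]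
  exact pow_le_pow_left₀ (by positivity) (mul_le_of_le_one_left (norm_nonneg _) (ht j)) 2

variable {Y : Type*} [Fintype Y]

/-- The state `∑ j, a j • |u j⟩ |g j⟩`. -/
noncomputable def schmidtState (a : Fin d → ℂ) (g : Fin d → Y → ℂ) : Fin d × Y → ℂ :=
  fun z => ∑ j, (a j * g j z.2) * u j z.1

theorem sum_norm_sq_schmidtState (a : Fin d → ℂ) {g : Fin d → Y → ℂ}
    (hg : ∀ j, ∑ y, ‖g j y‖ ^ 2 = 1) :
    ∑ z, ‖schmidtState u a g z‖ ^ 2 = ∑ j, ‖a j‖ ^ 2 := by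
  rw [Fintype.sum_prod_type_right]
  simp_rw [schmidtState, sum_norm_sq_combination]
  rw [Finset.sum_comm]
  simp_rw [norm_mul, mul_pow, ← Finset.mul_sum, hg, mul_one]

/-- A filter diagonal in the Schmidt basis of the reference rescales the Schmidt coefficients and
leaves the partner vectors `g j` alone. These need not be orthogonal. -/
theorem applyRef_schmidtState (t a : Fin d → ℂ) (g : Fin d → Y → ℂ) :
    applyRef (diagonalRef u t) (schmidtState u a g) = schmidtState u (fun j => t j * a j) g := by
  funext ⟨x, y⟩
  have h := diagonalRef_mulVec u t (fun x' => schmidtState u a g (x', y)) x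
  refine h.trans (Finset.sum_congr rfl fun j _ => ?_)
  have h2 : ∑ x', star (u j x') * schmidtState u a g (x', y) = a j * g j y := by
    simp only [schmidtState, Finset.mul_sum]
    rw [Finset.sum_comm]
    calc _ = ∑ i, (a i * g i y) * ∑ x', star (u j x') * u i x' := by
          simp only [Finset.mul_sum]
          exact Finset.sum_congr rfl fun _ _ => Finset.sum_congr rfl fun _ _ => by ring
      _ = _ := by simp_rw [sum_star_mul_basis]; simp
  rw [h2]
  ring

theorem smul_schmidtState (s : ℂ) (a : Fin d → ℂ) (g : Fin d → Y → ℂ) :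
    s • schmidtState u a g = schmidtState u (fun j => s * a j) g := by
  funext z
  simp only [schmidtState, Pi.smul_apply, smul_eq_mul, Finset.mul_sum, mul_assoc]

variable {e : Fin d → ℝ} {l : Fin d}

/-- The filter that makes the Schmidt coefficients `√(e j)` equal is a contraction. -/
theorem norm_sqrt_div_le_one (he : ∀ j, 0 < e j) (hl : ∀ j, e l ≤ e j) (j : Fin d) :
    ‖((√(e l / e j) : ℝ) : ℂ)‖ ≤ 1 := by
  rw [Complex.norm_real, Real.norm_of_nonneg (Real.sqrt_nonneg _)]
  exact Real.sqrt_le_one.2 ((div_le_one (he j)).2 (hl j))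

/-- Both sides equal `√(e l)`, independently of `j`: the filtered coefficients are uniform, and the
norm of the filtered state is `s = √(e l * d)`. -/
theorem sqrt_div_mul_sqrt (he : ∀ j, 0 < e j) (j : Fin d) :
    ((√(e l / e j) : ℝ) : ℂ) * ((√(e j) : ℝ) : ℂ)
      = ((√(e l * d) : ℝ) : ℂ) * (1 / ((√(d : ℝ) : ℝ) : ℂ)) := by
  have hd : 0 < √(d : ℝ) := Real.sqrt_pos.2 (by exact_mod_cast l.pos)
  have h : √(e l / e j) * √(e j) = √(e l * d) * (1 / √(d : ℝ)) := by
    rw [← Real.sqrt_mul (div_pos (he l) (he j)).le, div_mul_cancel₀ _ (he j).ne',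
      Real.sqrt_mul (he l).le, mul_one_div, mul_div_cancel_right₀ _ hd.ne']
  exact_mod_cast h

theorem sum_norm_sq_sqrt (he : ∀ j, 0 < e j) (he_sum : ∑ j, e j = 1) :
    ∑ j, ‖((√(e j) : ℝ) : ℂ)‖ ^ 2 = 1 := by
  rw [← he_sum]
  refine Finset.sum_congr rfl fun j _ => ?_
  rw [Complex.norm_real, Real.norm_of_nonneg (Real.sqrt_nonneg _), Real.sq_sqrt (he j).le]

theorem sum_norm_sq_uniform (hd : 0 < d) :
    ∑ _j : Fin d, ‖1 / ((√(d : ℝ) : ℝ) : ℂ)‖ ^ 2 = 1 := by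
  have : (0 : ℝ) < d := by exact_mod_cast hd
  rw [norm_div, norm_one, Complex.norm_real, Real.norm_of_nonneg (Real.sqrt_nonneg _), div_pow,
    Real.sq_sqrt this.le, Finset.sum_const, Finset.card_univ, Fintype.card_fin]
  rw [nsmul_eq_mul, one_pow, mul_one_div_cancel this.ne']

theorem tripartite_eq_schmidtState (e : Fin d → ℝ) (v w : Fin d → EuclideanSpace ℂ (Fin d)) :
    tripartite e u v w
      = schmidtState u (fun j => ((√(e j) : ℝ) : ℂ)) fun j y => v j y.1 * w j y.2 := by
  funext ⟨x, b, c⟩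
  exact Finset.sum_congr rfl fun j _ => by ring

theorem tripartiteGHZ_eq_schmidtState (v w : Fin d → EuclideanSpace ℂ (Fin d)) :
    tripartiteGHZ u v w
      = schmidtState u (fun _ => 1 / ((√(d : ℝ) : ℝ) : ℂ)) fun j y => v j y.1 * w j y.2 := by
  funext ⟨x, b, c⟩
  rw [tripartiteGHZ, Finset.mul_sum]
  exact Finset.sum_congr rfl fun j _ => by ring

theorem PsiTransfer_eq_schmidtState (e : Fin d → ℝ) (w : Fin d → EuclideanSpace ℂ (Fin d)) :
    PsiTransfer e u w
      = schmidtState u (fun j => ((√(e j) : ℝ) : ℂ)) fun j (y : Unit × Fin d × Unit) =>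
        w j y.2.1 := by
  funext ⟨x, b, c, a⟩
  exact Finset.sum_congr rfl fun j _ => by ring

theorem omegaTransfer_eq_schmidtState (w : Fin d → EuclideanSpace ℂ (Fin d)) :
    omegaTransfer u w
      = schmidtState u (fun _ => 1 / ((√(d : ℝ) : ℝ) : ℂ)) fun j (y : Unit × Fin d × Unit) =>
        w j y.2.1 := by
  funext ⟨x, b, c, a⟩
  rw [omegaTransfer, Finset.mul_sum]
  exact Finset.sum_congr rfl fun j _ => by ring

theorem sum_norm_sq_product_basis
    (v w : OrthonormalBasis (Fin d) ℂ (EuclideanSpace ℂ (Fin d))) (j : Fin d) :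
    ∑ y : Fin d × Fin d, ‖v j y.1 * w j y.2‖ ^ 2 = 1 := by
  simp_rw [Fintype.sum_prod_type, norm_mul, mul_pow, ← Finset.mul_sum, sum_norm_sq_basis, mul_one]
  exact sum_norm_sq_basis v j

theorem sum_norm_sq_transfer_basis
    (w : OrthonormalBasis (Fin d) ℂ (EuclideanSpace ℂ (Fin d))) (j : Fin d) :
    ∑ y : Unit × Fin d × Unit, ‖w j y.2.1‖ ^ 2 = 1 := by
  simp [Fintype.sum_prod_type, sum_norm_sq_basis w j]

end Schmidt

/-! ### States controlled by the register `R_A` -/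

section Controlled

variable {d da : ℕ}

theorem controlled_apply (φ : Fin da → Fin d × Fin d × Fin d → ℂ) (xa : Fin da) (x b c : Fin d)
    (y : Fin da) :
    controlled φ ((xa, x), b, c, y)
      = if xa = y then 1 / ((√(da : ℝ) : ℝ) : ℂ) * φ y (x, b, c) else 0 := by
  rw [controlled, Finset.sum_eq_single y (fun a _ ha => by simp [ha.symm]) (by simp)]
  by_cases h : xa = y <;> simp [h]

theorem sum_norm_sq_controlled (hda : 0 < da) {φ : Fin da → Fin d × Fin d × Fin d → ℂ}
    (hφ : ∀ a, ∑ z, ‖φ a z‖ ^ 2 = 1) : ∑ z, ‖controlled φ z‖ ^ 2 = 1 := by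
  let f : ((Fin da × Fin d) × Fin d × Fin d × Fin da) ≃
      (Fin da × Fin da) × (Fin d × Fin d × Fin d) :=
    ⟨fun z => ((z.2.2.2, z.1.1), (z.1.2, z.2.1, z.2.2.1)),
      fun w => ((w.1.2, w.2.1), w.2.2.1, w.2.2.2, w.1.1), fun _ => rfl, fun _ => rfl⟩
  have hval : ∀ y xa z, ‖controlled φ (f.symm ((y, xa), z))‖ ^ 2
      = if xa = y then ‖1 / ((√(da : ℝ) : ℝ) : ℂ)‖ ^ 2 * ‖φ y z‖ ^ 2 else 0 := fun y xa z => by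
    have : f.symm ((y, xa), z) = ((xa, z.1), z.2.1, z.2.2, y) := rfl
    rw [this, controlled_apply]
    split_ifs <;> simp [mul_pow]
  rw [← f.symm.sum_comp, Fintype.sum_prod_type, Fintype.sum_prod_type,
    ← sum_norm_sq_uniform hda]
  refine Finset.sum_congr rfl fun y _ => ?_
  simp_rw [hval]
  rw [Finset.sum_eq_single y (fun a _ ha => by simp [ha]) (by simp)]
  simp_rw [if_true, ← Finset.mul_sum, hφ, mul_one]

/-- One filter serves all values of `a`, because the basis `u` of the reference does not depend on
`a`; only `v` and `w` do. -/
theorem applyRef_controlled {T : Matrix (Fin d) (Fin d) ℂ} {s : ℂ}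
    {φ χ : Fin da → Fin d × Fin d × Fin d → ℂ} (h : ∀ a, applyRef T (φ a) = s • χ a) :
    applyRef ((1 : Matrix (Fin da) (Fin da) ℂ) ⊗ₖ T) (controlled φ) = s • controlled χ := by
  funext ⟨⟨xa, x⟩, b, c, y⟩
  have hy : ∑ x', T x x' * φ y (x', b, c) = s * χ y (x, b, c) := congr_fun (h y) (x, b, c)
  simp only [applyRef, Pi.smul_apply, smul_eq_mul, controlled_apply, Fintype.sum_prod_type,
    Matrix.kroneckerMap_apply]
  rw [Finset.sum_eq_single xa (fun a _ ha => by simp [ha.symm]) (by simp)]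
  split_ifs
  · rw [mul_left_comm, ← hy, Finset.mul_sum]
    exact Finset.sum_congr rfl fun _ _ => by rw [Matrix.one_apply_eq]; ring
  · simp

theorem sum_norm_sq_one_kronecker_le {T : Matrix (Fin d) (Fin d) ℂ}
    (hT : ∀ y : Fin d → ℂ, ∑ x, ‖(T *ᵥ y) x‖ ^ 2 ≤ ∑ x, ‖y x‖ ^ 2) (y : Fin da × Fin d → ℂ) :
    ∑ x, ‖(((1 : Matrix (Fin da) (Fin da) ℂ) ⊗ₖ T) *ᵥ y) x‖ ^ 2 ≤ ∑ x, ‖y x‖ ^ 2 := by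
  rw [Fintype.sum_prod_type, Fintype.sum_prod_type]
  refine Finset.sum_le_sum fun a _ => ?_
  refine le_trans (le_of_eq ?_) (hT fun x => y (a, x))
  refine Finset.sum_congr rfl fun x _ => ?_
  congr 2
  simp only [Matrix.mulVec, dotProduct, Fintype.sum_prod_type, Matrix.kroneckerMap_apply]
  rw [Finset.sum_eq_single a (fun a' _ ha => by simp [ha.symm]) (by simp)]
  simp

end Controlled

end StateRedistribution

/-! ### The lemma for redistribution and for state transfer -/

open StateRedistribution in
theorem lemma4p3
    (r : ℕ) (hr : Odd r)
    (d : ℕ) (hd : 0 < d)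
    (e : Fin d → ℝ) (he_anti : Antitone e) (he_pos : ∀ j, 0 < e j) (he_sum : ∑ j, e j = 1)
    (ε C μ : ℝ) (hε : ε < 1) (hμ : 0 < μ) :
    (∀ (da : ℕ), 0 < da →
      ∀ (u : OrthonormalBasis (Fin d) ℂ (EuclideanSpace ℂ (Fin d)))
        (v w : Fin da → OrthonormalBasis (Fin d) ℂ (EuclideanSpace ℂ (Fin d)))
        (P : Protocol (Fin da) (Fin d) (Fin d) r),
        P.Redistributes (Psi e u (fun a => v a) (fun a => w a)) ε →
        P.expectedCost (Psi e u (fun a => v a) (fun a => w a)) ≤ C →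
        ∃ P' : Protocol (Fin da) (Fin d) (Fin d) r,
          P'.WorstCaseCostLE (2 * C / (μ * (1 - ε))) ∧
          P'.Redistributes (omega u (fun a => v a) (fun a => w a))
            (√(8 * ε / (e ⟨d - 1, Nat.sub_lt hd Nat.one_pos⟩ * d)) + √μ)) ∧
    (∀ (u w : OrthonormalBasis (Fin d) ℂ (EuclideanSpace ℂ (Fin d)))
        (P : Protocol Unit Unit (Fin d) r),
        P.Redistributes (PsiTransfer e u w) ε →
        P.expectedCost (PsiTransfer e u w) ≤ C →
        ∃ P' : Protocol Unit Unit (Fin d) r,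
          P'.WorstCaseCostLE (2 * C / (μ * (1 - ε))) ∧
          P'.Redistributes (omegaTransfer u w)
            (√(8 * ε / (e ⟨d - 1, Nat.sub_lt hd Nat.one_pos⟩ * d)) + √μ)) := by
  -- The last index carries the smallest coefficient, since `e` is antitone.
  set l : Fin d := ⟨d - 1, Nat.sub_lt hd Nat.one_pos⟩ with hl
  have hmin : ∀ j, e l ≤ e j := fun j => he_anti (Fin.le_def.2 (Nat.le_sub_one_of_lt j.isLt))
  have hpos : 0 < e l * d := mul_pos (he_pos l) (by exact_mod_cast hd)
  have hs : 0 < √(e l * d) := Real.sqrt_pos.2 hpos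
  have hsq : √(e l * d) ^ 2 = e l * d := Real.sq_sqrt hpos.le
  refine ⟨fun da hda u v w P hP hC => ?_, fun u w P hP hC => ?_⟩
  · rw [← hsq]
    refine P.exists_worstCaseCostLE
      (sum_norm_sq_controlled hda fun a => ?_) (sum_norm_sq_controlled hda fun a => ?_)
      (sum_norm_sq_one_kronecker_le (sum_norm_sq_diagonalRef_le u (norm_sqrt_div_le_one he_pos hmin)))
      hs (applyRef_controlled fun a => ?_) hε hμ hP hC
    · rw [tripartite_eq_schmidtState, sum_norm_sq_schmidtState u _
        (sum_norm_sq_product_basis (v a) (w a)), sum_norm_sq_sqrt he_pos he_sum]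
    · rw [tripartiteGHZ_eq_schmidtState, sum_norm_sq_schmidtState u _
        (sum_norm_sq_product_basis (v a) (w a)), sum_norm_sq_uniform hd]
    · rw [tripartite_eq_schmidtState, tripartiteGHZ_eq_schmidtState, applyRef_schmidtState,
        smul_schmidtState]
      simp_rw [sqrt_div_mul_sqrt he_pos]
  · rw [← hsq]
    refine P.exists_worstCaseCostLE ?_ ?_
      (sum_norm_sq_diagonalRef_le u (norm_sqrt_div_le_one he_pos hmin)) hs ?_ hε hμ hP hC
    · rw [PsiTransfer_eq_schmidtState, sum_norm_sq_schmidtState u _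
        (sum_norm_sq_transfer_basis w), sum_norm_sq_sqrt he_pos he_sum]
    · rw [omegaTransfer_eq_schmidtState, sum_norm_sq_schmidtState u _
        (sum_norm_sq_transfer_basis w), sum_norm_sq_uniform hd]
    · rw [PsiTransfer_eq_schmidtState, omegaTransfer_eq_schmidtState, applyRef_schmidtState,
        smul_schmidtState]
      simp_rw [sqrt_div_mul_sqrt he_pos]
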